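/- Conventions. An oriented generalized circle (circle or line) in the plane has a signed curvature, negative exactly when its chosen interior is the unbounded side, and $0$ for a line. An octahedral base configuration consists of six oriented circles whose interiors are pairwise disjoint, at most one of them of negative curvature, and whose tangency graph is the graph of the octahedron, together with the dual configuration: eight circles, one for each face, whose tangency graph is the cube, each orthogonal to the three base circles of its face and disjoint from the other base circles. The octahedral packing $\mathcal A$ is the orbit of the six base circles under the group generated by the reflections across the eight dual circles. It is integral if all its curvatures are integers, and primitive if moreover the greatest common divisor of its curvatures is $1$. A primitive integral octahedral packing has type $(0,3,6)$, respectively $(4,5,6)$, modulo $8$ if the curvatures $(a,b,c,d,e,f)$ of a base configuration, with opposite pairs $\{a,f\},\{b,e\},\{c,d\}$, are, up to a symmetry of the octahedron, congruent modulo $8$ to $(3,0,6,0,6,3)$, respectively $(5,4,6,4,6,5)$. Let $\left(\frac{\cdot}{\cdot}\right)$ be the Kronecker symbol. For tangent circles $\mathcal C_1,\mathcal C_2$ with coprime curvatures $a,b$ put, in type $(0,3,6)$, $$\chi_2(\mathcal C_1,\mathcal C_2)=\begin{cases}\left(\frac{a+b}{a}\right)& a\not\equiv 0,6 \pmod 8,\\[2pt]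 \left(\frac{a+b}{a/2}\right)& a\equiv 6\pmod 8,\\[2pt] \left(\frac{-(a+b)}{a}\right)& a\equiv 0\pmod 8,\end{cases}$$ and, in type $(4,5,6)$, $\chi_2(\mathcal C_1,\mathcal C_2)=\left(\frac{a+b}{a}\right)$. Statement. Let $\mathcal A$ be a primitive integral octahedral packing of type $(0,3,6)$ or $(4,5,6)$ modulo $8$, and let its circles be coloured yellow, red and blue so that tangent circles have different colours and the circles of odd curvature are exactly the yellow ones. Then: (1) There is $\varepsilon\in\{1,-1\}$ such that $\chi_2(\mathcal C_1,\mathcal C_2)=\varepsilon$ for all pairs of tangent circles of coprime curvatures, one yellow and the other red (in either order), and $\chi_2(\mathcal C_1,\mathcal C_2)=-\varepsilon$ for all pairs of tangent circles of coprime curvatures, one yellow and the other blue (in either order). (2) If $\chi_2=1$ on the yellow–red pairs and $\chi_2=-1$ on the yellow–blue pairs, then no blue circle has curvature of the form $n^2$ and no red circle has curvature of the form $2n^2$, with $n\in\mathbb Z$. -/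

import Mathlib

/-- An oriented generalized circle (circle or line) of the complex plane in inversive coordinates
`(cocurv, curv, hx, hy)`.  If `curv ≠ 0` it is the circle with centre `(hx / curv, hy / curv)` and
radius `1 / |curv|`; if `curv = 0` it is a line with unit normal vector `(hx, hy)`.  Its interior is
`{z | curv * |z| ^ 2 - 2 * (hx * z.re + hy * z.im) + cocurv < 0}`, so a negative
curvature means that the interior is the unbounded side. -/
@[ext]
structure OrientedCircle where
  cocurv : ℝ
  curv : ℝ
  hx : ℝ
  hy : ℝ
  norm_eq : hx ^ 2 + hy ^ 2 - curv * cocurv = 1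

namespace OrientedCircle

/-- The inner product of two oriented circles, i.e. the symmetric bilinear form attached to the
quadratic form `hx ^ 2 + hy ^ 2 - curv * cocurv`. -/
noncomputable def pairing (C D : OrientedCircle) : ℝ :=
  C.hx * D.hx + C.hy * D.hy - (C.curv * D.cocurv + C.cocurv * D.curv) / 2

/-- The circles are tangent, with opposite unit normals at the point of tangency. -/
def Tangent (C D : OrientedCircle) : Prop := C.pairing D = -1

/-- The circles are disjoint, and they are oriented away from each other. -/
def Separated (C D : OrientedCircle) : Prop := C.pairing D < -1

/-- The circles intersect orthogonally. -/
def Orthogonal (C D : OrientedCircle) : Prop := C.pairing D = 0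

/-- The image of the circle `C` under the reflection (inversion) across the circle `D`. -/
noncomputable def reflect (D C : OrientedCircle) : OrientedCircle where
  cocurv := C.cocurv - 2 * C.pairing D * D.cocurv
  curv := C.curv - 2 * C.pairing D * D.curv
  hx := C.hx - 2 * C.pairing D * D.hx
  hy := C.hy - 2 * C.pairing D * D.hy
  norm_eq := by
    have hC := C.norm_eq
    have hD := D.norm_eq
    unfold pairing
    linear_combination hC + 4 * (C.hx * D.hx + C.hy * D.hy -
      (C.curv * D.cocurv + C.cocurv * D.curv) / 2) ^ 2 * hD

theorem pairing_reflect (D C : OrientedCircle) : (reflect D C).pairing D = -C.pairing D := by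
  have hD := D.norm_eq
  simp only [reflect, pairing]
  linear_combination (-2) * (C.hx * D.hx + C.hy * D.hy -
    (C.curv * D.cocurv + C.cocurv * D.curv) / 2) * hD

theorem reflect_reflect (D C : OrientedCircle) : reflect D (reflect D C) = C := by
  have h := pairing_reflect D C
  ext
  · change (reflect D C).cocurv - 2 * (reflect D C).pairing D * D.cocurv = C.cocurv
    rw [h]; simp only [reflect]; ring
  · change (reflect D C).curv - 2 * (reflect D C).pairing D * D.curv = C.curv
    rw [h]; simp only [reflect]; ring
  · change (reflect D C).hx - 2 * (reflect D C).pairing D * D.hx = C.hx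
    rw [h]; simp only [reflect]; ring
  · change (reflect D C).hy - 2 * (reflect D C).pairing D * D.hy = C.hy
    rw [h]; simp only [reflect]; ring

/-- Reflection across `D`, as a permutation of the set of oriented circles. -/
noncomputable def reflection (D : OrientedCircle) : Equiv.Perm OrientedCircle where
  toFun := reflect D
  invFun := reflect D
  left_inv := reflect_reflect D
  right_inv := reflect_reflect D

end OrientedCircle

/-- A vertex of the octahedron: one of the three axes together with an end of that axis.  Two
vertices are adjacent iff they lie on different axes; `(i, s)` and `(i, !s)` are opposite. -/
abbrev OctVertex := Fin 3 × Bool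

/-- A face of the octahedron: a choice of one end on every axis.  The vertex `p` lies on the face
`φ` iff `φ p.1 = p.2`, and two faces share an edge iff they differ on exactly one axis. -/
abbrev OctFace := Fin 3 → Bool

/-- A base configuration of six circles whose tangency graph is the octahedron, with the dual
configuration of eight circles whose tangency graph is the dual graph, the cube.  A base circle and
a dual circle are orthogonal when the vertex lies on the face, and disjoint otherwise. -/
structure OctahedralConfiguration where
  base : OctVertex → OrientedCircle
  dual : OctFace → OrientedCircle
  base_tangent : ∀ p q : OctVertex, p.1 ≠ q.1 → (base p).Tangent (base q)
  base_separated : ∀ (i : Fin 3) (s : Bool), (base (i, s)).Separated (base (i, !s))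
  dual_tangent : ∀ φ ψ : OctFace, (∃! i, φ i ≠ ψ i) → (dual φ).Tangent (dual ψ)
  dual_separated : ∀ φ ψ : OctFace, φ ≠ ψ → (¬ ∃! i, φ i ≠ ψ i) → (dual φ).Separated (dual ψ)
  base_dual_orthogonal : ∀ (p : OctVertex) (φ : OctFace), φ p.1 = p.2 →
    (base p).Orthogonal (dual φ)
  base_dual_separated : ∀ (p : OctVertex) (φ : OctFace), φ p.1 ≠ p.2 →
    (base p).Separated (dual φ)
  /-- The standard orientation: at most one base circle has negative curvature. -/
  base_orientation : ∀ p q : OctVertex, (base p).curv < 0 → (base q).curv < 0 → p = q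

namespace OctahedralConfiguration

/-- The octahedral Apollonian group, generated by the reflections across the dual circles. -/
noncomputable def apollonianGroup (P : OctahedralConfiguration) :
    Subgroup (Equiv.Perm OrientedCircle) :=
  Subgroup.closure (Set.range fun φ : OctFace => (P.dual φ).reflection)

/-- The octahedral packing: the orbit of the base circles under the Apollonian group. -/
def packing (P : OctahedralConfiguration) : Set OrientedCircle :=
  {C | ∃ g ∈ P.apollonianGroup, ∃ p : OctVertex, C = g (P.base p)}

/-- All curvatures in the packing are integers. -/
def IsIntegral (P : OctahedralConfiguration) : Prop :=
  ∀ C ∈ P.packing, ∃ n : ℤ, C.curv = n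

/-- The greatest common divisor of the curvatures in the (integral) packing is `1`. -/
def IsPrimitive (P : OctahedralConfiguration) : Prop :=
  ∀ d : ℕ, (∀ C ∈ P.packing, ∃ n : ℤ, C.curv = d * n) → d = 1

end OctahedralConfiguration

/-- The two congruence types modulo `8` under consideration. -/
inductive OctType
  | t036
  | t456

/-- The odd residue of the type. -/
def OctType.oddResidue : OctType → ℤ
  | .t036 => 3
  | .t456 => 5

/-- The first even residue of the type. -/
def OctType.evenResidue₁ : OctType → ℤ
  | .t036 => 0
  | .t456 => 4

/-- The second even residue of the type. -/
def OctType.evenResidue₂ : OctType → ℤ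
  | .t036 => 6
  | .t456 => 6

/-- The curvature of `C` is an integer congruent to `r` modulo `8`. -/
def OrientedCircle.CurvModEight (C : OrientedCircle) (r : ℤ) : Prop :=
  ∃ n : ℤ, C.curv = n ∧ n ≡ r [ZMOD 8]

/-- The base sextuple is congruent modulo `8`, up to the symmetries of the octahedron, to the
sextuple of the given type: `(3,0,6,0,6,3)` or `(5,4,6,4,6,5)` for `(a,b,c,d,e,f)` in the order in
which `a, f` and `b, e` and `c, d` are the opposite pairs.  So both ends of one axis have the odd
residue, and each of the other two axes has one end with each even residue. -/
def OctahedralConfiguration.HasType (P : OctahedralConfiguration) (T : OctType) : Prop :=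
  ∃ i : Fin 3, (∀ s : Bool, (P.base (i, s)).CurvModEight T.oddResidue) ∧
    ∀ j : Fin 3, j ≠ i → ∃ s : Bool, (P.base (j, s)).CurvModEight T.evenResidue₁ ∧
      (P.base (j, !s)).CurvModEight T.evenResidue₂

/-- The Kronecker symbol `(a / b)` for nonzero `b`: the product of the symbol at the sign of `b`, of
the symbol at `2` raised to the exponent of `2` in `b`, and of the Jacobi symbol at the odd part
of `|b|`. -/
def kroneckerSymbol (a b : ℤ) : ℤ :=
  (if a < 0 ∧ b < 0 then -1 else 1) * ZMod.χ₈ a ^ padicValNat 2 b.natAbs *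
    jacobiSym a (b.natAbs / 2 ^ padicValNat 2 b.natAbs)

/-- The symbol `χ₂` of a pair of tangent circles with coprime curvatures `a`, `b`, in a packing of
type `T`. -/
def chiTwo (T : OctType) (a b : ℤ) : ℤ :=
  match T with
  | .t036 =>
      if a % 8 = 6 then kroneckerSymbol (a + b) (a / 2)
      else if a % 8 = 0 then kroneckerSymbol (-(a + b)) a
      else kroneckerSymbol (a + b) a
  | .t456 => kroneckerSymbol (a + b) a

inductive OctColor
  | yellow
  | red
  | blue

namespace OctahedralConfiguration

/-- `κ` is a 3-colouring of the packing (tangent circles get different colours) in which the yellow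
circles are exactly the circles of odd curvature, so that the even circles are red and blue. -/
structure IsColoring (P : OctahedralConfiguration) (κ : OrientedCircle → OctColor) : Prop where
  proper : ∀ C ∈ P.packing, ∀ D ∈ P.packing, C.Tangent D → κ C ≠ κ D
  odd_yellow : ∀ C ∈ P.packing, ∀ n : ℤ, C.curv = n → (κ C = .yellow ↔ Odd n)

/-- For every pair of tangent circles with coprime curvatures in the packing, one yellow and the
other of colour `c`, the symbol `χ₂` of the pair, taken in either order, equals `ε`. -/
def ChiTwoConstant (P : OctahedralConfiguration) (T : OctType) (κ : OrientedCircle → OctColor)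
    (c : OctColor) (ε : ℤ) : Prop :=
  ∀ C ∈ P.packing, ∀ D ∈ P.packing, C.Tangent D → κ C = .yellow → κ D = c →
    ∀ a b : ℤ, C.curv = a → D.curv = b → IsCoprime a b →
      chiTwo T a b = ε ∧ chiTwo T b a = ε

end OctahedralConfiguration

/-!
The circles of the packing are the integer vectors of a lattice. Rigidity of the base configuration
(`coords_add_coords_not`) shows that the six base circles are `w + uᵢ` and `w - uᵢ`, where
`w, u₀, u₁, u₂` are pairwise orthogonal with norms `-1, 2, 2, 2`, and that the eight reflections
act on the coordinates `(n; m₀, m₁, m₂)` by integer matrices, trivially modulo `2`. So every circle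
lies on one axis, its colour depends only on this axis (`exists_axis_color`), and the curvature
functional `(s; x₀, x₁, x₂)` satisfies `∑ xᵢ² = 2 s²` in every configuration of the packing.

Descent in `n` shows that tangent circles lie in a common configuration and that the circles tangent
to a fixed circle `C` are indexed by Pythagorean parameters `X, Y` (`tangent_vertex_structure`). If
`a` is the curvature of `C`, then the sums `a + b`, with `b` the curvature of a tangent circle, are
the values `f(X, Y)` on one axis and `f(X, Y) / 2` on the other, for a binary quadratic form `f` of
discriminant `-8 a²`. Products of two values of `f` are therefore squares modulo `a`
(`exists_mul_eq`). Hence for odd `a` the symbol is constant on each of the two even colours, with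
opposite values because the Jacobi symbol of `2` at `|a| ≡ ±3 mod 8` is `-1`; for even `a` it is
constant on the odd neighbours. Quadratic reciprocity gives `χ₂(C, D) = χ₂(D, C)` (`chiTwo_comm`).

It remains to connect all circles through pairs of coprime curvatures. The circles tangent to two
given tangent circles have curvatures quadratic in an index, and by primitivity an odd prime cannot
divide them all. So one of them is coprime to any prescribed nonzero number that is odd, or that is
arbitrary when the curvatures in the sequence are odd (`Admissible.exists_isCoprime`). This links the two odd circles of every configuration
(`signedChi_eq_of_opposite`), and adjacent configurations share an odd circle.

For the second assertion, an even circle of curvature `n²` or `2 n²` has a coprime odd neighbour,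
and its symbol there is `1` or `-1` by inspection (`chiTwo_even_sq`, `chiTwo_even_two_mul_sq`).
Curvature `0` cannot occur: two coprime odd neighbours would have odd squares as curvatures, which
are `1` modulo `8` (`eval_ne_zero`).
-/

/-! ### The lattice of a configuration -/

/-- The sign attached to an end of an axis. -/
def endSign (s : Bool) : ℤ := if s then 1 else -1

theorem endSign_mul_self (s : Bool) : endSign s * endSign s = 1 := by cases s <;> rfl

theorem endSign_not (s : Bool) : endSign (!s) = -endSign s := by cases s <;> rfl

theorem endSign_eq (s : Bool) : endSign s = 1 ∨ endSign s = -1 := by cases s <;> simp [endSign]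

theorem sum_axes {M : Type*} [AddCommMonoid M] (f : Fin 3 → M) {i j k : Fin 3} (hij : i ≠ j)
    (hik : i ≠ k) (hjk : j ≠ k) : ∑ l, f l = f i + f j + f k := by
  rw [Fin.sum_univ_three]
  fin_cases i <;> fin_cases j <;> fin_cases k <;>
    first | exact absurd rfl ‹_› | (simp; done) | (simp; abel)

theorem exists_other_axis (i : Fin 3) : ∃ j, i ≠ j := by
  revert i; decide

theorem exists_third_axis {i j : Fin 3} (hij : i ≠ j) : ∃ k, i ≠ k ∧ j ≠ k := by
  revert i j; decide

theorem axis_cases {i j k : Fin 3} (hij : i ≠ j) (hik : i ≠ k) (hjk : j ≠ k) (l : Fin 3) :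
    l = i ∨ l = j ∨ l = k := by
  revert i j k l; decide

/-- Integer coordinates `(n; m₀, m₁, m₂)` of a vector in the lattice spanned by a base
configuration: the vector is `n w + ∑ mᵢ uᵢ`, where the two base circles on the axis `i`
are `w + uᵢ` and `w - uᵢ`. -/
@[ext]
structure OctVec where
  n : ℤ
  m : Fin 3 → ℤ

namespace OctVec

/-- The pairing of circles in lattice coordinates. -/
def form (v w : OctVec) : ℤ := 2 * ∑ i, v.m i * w.m i - v.n * w.n

/-- The position of a vector relative to the mirror of the face `φ`: up to the factor `√2`, its
pairing with the dual circle of `φ`. -/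
def height (φ : OctFace) (v : OctVec) : ℤ := ∑ i, endSign (φ i) * v.m i - v.n

/-- The reflection across the dual circle of the face `φ`. -/
def refl (φ : OctFace) (v : OctVec) : OctVec where
  n := v.n - 4 * height φ v
  m i := v.m i - 2 * height φ v * endSign (φ i)

/-- The coordinates of a base circle. -/
def vertex (p : OctVertex) : OctVec := ⟨1, fun i => if i = p.1 then endSign p.2 else 0⟩

/-- The product of the reflections of a list of faces. -/
def word (l : List OctFace) (v : OctVec) : OctVec := l.foldr refl v

theorem height_refl (φ : OctFace) (v : OctVec) : height φ (refl φ v) = -height φ v := by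
  have h0 := endSign_mul_self (φ 0)
  have h1 := endSign_mul_self (φ 1)
  have h2 := endSign_mul_self (φ 2)
  simp only [height, refl, Fin.sum_univ_three]
  linear_combination (-2 * (endSign (φ 0) * v.m 0 + endSign (φ 1) * v.m 1 +
    endSign (φ 2) * v.m 2 - v.n)) * (h0 + h1 + h2)

theorem refl_refl (φ : OctFace) (v : OctVec) : refl φ (refl φ v) = v := by
  have h := height_refl φ v
  ext i
  · change (refl φ v).n - 4 * height φ (refl φ v) = _
    rw [h]; simp only [refl]; ring
  · change (refl φ v).m i - 2 * height φ (refl φ v) * endSign (φ i) = _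
    rw [h]; simp only [refl]; ring

theorem form_refl_refl (φ : OctFace) (v w : OctVec) :
    form (refl φ v) (refl φ w) = form v w := by
  have h0 := endSign_mul_self (φ 0)
  have h1 := endSign_mul_self (φ 1)
  have h2 := endSign_mul_self (φ 2)
  have e1 : height φ v = ∑ i, endSign (φ i) * v.m i - v.n := rfl
  have e2 : height φ w = ∑ i, endSign (φ i) * w.m i - w.n := rfl
  simp only [form, refl, Fin.sum_univ_three] at *
  generalize height φ v = a at *
  generalize height φ w = b at *
  linear_combination (8 * a * b) * (h0 + h1 + h2) + 4 * b * e1 + 4 * a * e2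

theorem form_comm (v w : OctVec) : form v w = form w v := by
  simp only [form, Fin.sum_univ_three]; ring

theorem word_append (l l' : List OctFace) (v : OctVec) : word (l ++ l') v = word l (word l' v) := by
  simp [word]

theorem word_concat (l : List OctFace) (φ : OctFace) (v : OctVec) :
    word (l ++ [φ]) v = word l (refl φ v) := word_append l [φ] v

theorem word_reverse_word (l : List OctFace) (v : OctVec) : word l.reverse (word l v) = v := by
  induction l generalizing v with
  | nil => rfl
  | cons φ l ih =>
    rw [List.reverse_cons, word_append]
    change word l.reverse (refl φ (refl φ (word l v))) = v
    rw [refl_refl, ih]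

theorem word_word_reverse (l : List OctFace) (v : OctVec) : word l (word l.reverse v) = v := by
  simpa using word_reverse_word l.reverse v

theorem form_word_word (l : List OctFace) (v w : OctVec) : form (word l v) (word l w) = form v w := by
  induction l with
  | nil => rfl
  | cons φ l ih => exact (form_refl_refl φ _ _).trans ih

theorem odd_refl_m (φ : OctFace) (v : OctVec) (j : Fin 3) :
    Odd ((refl φ v).m j) ↔ Odd (v.m j) := by
  simp [refl, Int.odd_sub, mul_assoc]

theorem odd_word_m (l : List OctFace) (v : OctVec) (j : Fin 3) :
    Odd ((word l v).m j) ↔ Odd (v.m j) := by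
  induction l with
  | nil => rfl
  | cons φ l ih => exact (odd_refl_m φ _ j).trans ih

theorem odd_vertex_m (p : OctVertex) (j : Fin 3) : Odd ((vertex p).m j) ↔ j = p.1 := by
  rcases p with ⟨i, s⟩
  by_cases h : j = i <;> cases s <;> simp [vertex, h, endSign]

theorem form_vertex (i : Fin 3) (s : Bool) (v : OctVec) :
    form (vertex (i, s)) v = 2 * (endSign s * v.m i) - v.n := by
  simp [form, vertex]

theorem form_vertex_vertex {p q : OctVertex} (h : p.1 ≠ q.1) :
    form (vertex p) (vertex q) = -1 := by
  rw [show p = (p.1, p.2) from rfl, form_vertex]; simp [vertex, h]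

theorem refl_vertex {φ : OctFace} {p : OctVertex} (h : φ p.1 = p.2) :
    refl φ (vertex p) = vertex p := by
  have : height φ (vertex p) = 0 := by simp [height, vertex, h, endSign_mul_self]
  ext <;> simp [refl, this]

/-- Two different mirrors have no common point in their interiors, so a vector of the orbit lies
strictly inside at most one of them. -/
theorem height_add_height_nonpos {φ ψ : OctFace} (h : φ ≠ ψ) {v : OctVec} (hn : 1 ≤ v.n)
    (hv : form v v = 1) : height φ v + height ψ v ≤ 0 := by
  obtain ⟨i, hi⟩ : ∃ i, φ i ≠ ψ i := by by_contra! hc; exact h (funext hc)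
  obtain ⟨j, hij⟩ : ∃ j, i ≠ j := exists_other_axis i
  obtain ⟨k, hik, hjk⟩ := exists_third_axis hij
  have hi' : endSign (φ i) + endSign (ψ i) = 0 := by
    revert hi; cases φ i <;> cases ψ i <;> simp [endSign]
  have key : ∀ y : ℤ, y ^ 2 ≤ 2 * (v.m j ^ 2 + v.m k ^ 2) → y ≤ v.n := by
    intro y hy
    simp only [form, sum_axes _ hij hik hjk] at hv
    by_contra! hc
    nlinarith [sq_nonneg (v.m i)]
  simp only [height, sum_axes _ hij hik hjk]
  have h2 : ∀ a b : ℤ, (a = 0 ∨ a = 1 ∨ a = -1) → (b = 0 ∨ b = 1 ∨ b = -1) →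
      a * v.m j + b * v.m k ≤ v.n := by
    rintro a b ha hb
    apply key
    rcases ha with rfl | rfl | rfl <;> rcases hb with rfl | rfl | rfl <;>
      nlinarith [sq_nonneg (v.m j + v.m k), sq_nonneg (v.m j - v.m k), sq_nonneg (v.m j),
        sq_nonneg (v.m k)]
  have h3 : ∀ s t : Bool, ∃ a : ℤ, (a = 0 ∨ a = 1 ∨ a = -1) ∧ endSign s + endSign t = 2 * a := by
    intro s t
    cases s <;> cases t
    exacts [⟨-1, by simp [endSign]⟩, ⟨0, by simp [endSign]⟩, ⟨0, by simp [endSign]⟩,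
      ⟨1, by simp [endSign]⟩]
  obtain ⟨a, ha, ha'⟩ := h3 (φ j) (ψ j)
  obtain ⟨b, hb, hb'⟩ := h3 (φ k) (ψ k)
  linear_combination 2 * h2 a b ha hb + v.m i * hi' + v.m j * ha' + v.m k * hb'

/-- The lattice vectors obtained from base vectors by reflections each of which strictly increases
the coordinate `n`. -/
inductive Reached : OctVec → Prop
  | vertex (p : OctVertex) : Reached (vertex p)
  | refl (φ : OctFace) (v : OctVec) : Reached v → height φ v < 0 → Reached (refl φ v)

theorem form_vertex_self (p : OctVertex) : form (vertex p) (vertex p) = 1 := by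
  rw [show p = (p.1, p.2) from rfl, form_vertex]; simp [vertex, endSign_mul_self]

theorem Reached.form_self {v : OctVec} (h : Reached v) : form v v = 1 := by
  induction h with
  | vertex p => exact form_vertex_self p
  | refl φ v _ _ ih => rw [form_refl_refl, ih]

theorem Reached.one_le_n {v : OctVec} (h : Reached v) : 1 ≤ v.n := by
  induction h with
  | vertex p => exact le_rfl
  | refl φ v _ h ih => simp only [OctVec.refl]; linarith

/-- Heights are even, because both `n` and the sum of the `mᵢ` are odd. -/
theorem Reached.even_height {v : OctVec} (h : Reached v) (ψ : OctFace) : Even (height ψ v) := by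
  have hs : ∀ s, Odd (endSign s) := by intro s; cases s <;> decide
  have hn : Odd v.n := by
    by_contra hc
    rw [Int.not_odd_iff_even] at hc
    obtain ⟨a, ha⟩ := hc
    have := h.form_self
    simp only [form] at this
    generalize ∑ i, v.m i * v.m i = b at this
    rw [ha] at this
    have h2 : 2 * (b - (a + a) * a) = 1 := by linarith
    omega
  have hm : Odd (v.m 0 + v.m 1 + v.m 2) := by
    clear hn
    induction h with
    | vertex p =>
      have h0 := odd_vertex_m p 0
      have h1 := odd_vertex_m p 1
      have h2 := odd_vertex_m p 2
      rw [Int.odd_add, Int.odd_add, ← Int.not_odd_iff_even, ← Int.not_odd_iff_even, h0, h1, h2]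
      generalize p.1 = i
      revert i; decide
    | refl φ v _ _ ih =>
      have h0 := odd_refl_m φ v 0
      have h1 := odd_refl_m φ v 1
      have h2 := odd_refl_m φ v 2
      rw [Int.odd_add, Int.odd_add, ← Int.not_odd_iff_even, ← Int.not_odd_iff_even] at ih ⊢
      rwa [h0, h1, h2]
  simp only [height, Fin.sum_univ_three]
  obtain ⟨a, ha⟩ := hs (ψ 0)
  obtain ⟨b, hb⟩ := hs (ψ 1)
  obtain ⟨c, hc⟩ := hs (ψ 2)
  obtain ⟨d, hd⟩ := hm
  obtain ⟨e, he⟩ := hn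
  rw [ha, hb, hc, he]
  exact ⟨a * v.m 0 + b * v.m 1 + c * v.m 2 + d - e, by linear_combination hd⟩

theorem height_vertex_nonpos (φ : OctFace) (p : OctVertex) : height φ (vertex p) ≤ 0 := by
  simp only [height, vertex, mul_ite, mul_zero, Finset.sum_ite_eq', Finset.mem_univ, if_true]
  cases φ p.1 <;> cases p.2 <;> simp [endSign]

/-- The vectors reached are closed under all reflections: a mirror with the vector strictly inside
is unique, hence is the one crossed last. -/
theorem Reached.refl_mem {v : OctVec} (h : Reached v) (φ : OctFace) : Reached (OctVec.refl φ v) := by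
  rcases lt_trichotomy (height φ v) 0 with hlt | heq | hgt
  · exact Reached.refl φ v h hlt
  · have : OctVec.refl φ v = v := by ext <;> simp [OctVec.refl, heq]
    rwa [this]
  · cases h with
    | vertex p => exact absurd hgt (not_lt.2 (height_vertex_nonpos φ p))
    | refl ψ u hu hlt =>
      have hψ : φ = ψ := by
        by_contra hc
        have hr := Reached.refl ψ u hu hlt
        have := height_add_height_nonpos hc hr.one_le_n hr.form_self
        rw [height_refl] at this
        linarith
      subst hψ
      rwa [refl_refl]

theorem Reached.word_mem {v : OctVec} (h : Reached v) (l : List OctFace) : Reached (word l v) := by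
  induction l with
  | nil => exact h
  | cons φ l ih => exact ih.refl_mem φ

theorem Reached.exists_word {v : OctVec} (h : Reached v) : ∃ l p, v = word l (OctVec.vertex p) := by
  induction h with
  | vertex p => exact ⟨[], p, rfl⟩
  | refl φ v _ _ ih =>
    obtain ⟨l, p, rfl⟩ := ih
    exact ⟨φ :: l, p, rfl⟩

/-- Let `v` be tangent to the base circle `(i, s)` and put `r = ±mᵢ + 1`, with the sign of `s`.
Then `r ^ 2 = mⱼ ^ 2 + mₖ ^ 2`; the predicate says that `c` times this Pythagorean triple is
parametrized by integers `X` and `Y` in the usual way.  The cases `c = 1` and `c = 2` occur for `v`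
on the axes `j` and `k`. -/
def PythParam (c : ℤ) (s : Bool) (i j k : Fin 3) (v : OctVec) : Prop :=
  ∃ X Y : ℤ, c * (endSign s * v.m i + 1) = X ^ 2 + Y ^ 2 ∧ c * v.m j = X ^ 2 - Y ^ 2 ∧
    c * v.m k = 2 * X * Y

/-- A vector of the orbit tangent to a base circle is carried to another base circle by reflections
that fix the first one, and its coordinates are given by Pythagorean parameters. -/
theorem tangent_vertex_structure {v : OctVec} (h : Reached v) {i : Fin 3} {s : Bool}
    (ht : form (vertex (i, s)) v = -1) :
    (∃ l q, q.1 ≠ i ∧ word l (vertex (i, s)) = vertex (i, s) ∧ word l (vertex q) = v) ∧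
    ∀ j k, i ≠ j → i ≠ k → j ≠ k → (Odd (v.m j) → PythParam 1 s i j k v) ∧
      (Odd (v.m k) → PythParam 2 s i j k v) := by
  induction h with
  | vertex q =>
    have hq : q.1 ≠ i := by
      rintro rfl
      rw [form_vertex] at ht
      revert ht
      simp only [vertex, if_true]
      cases s <;> cases q.2 <;> simp [endSign]
    refine ⟨⟨[], q, hq, rfl, rfl⟩, fun j k hij hik hjk => ⟨fun hj => ?_, fun hk => ?_⟩⟩
    · rw [odd_vertex_m] at hj
      subst hj
      rcases q with ⟨j, t⟩
      cases t
      · exact ⟨0, 1, by simp [vertex, hij], by simp [vertex, endSign], by simp [vertex, hjk.symm]⟩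
      · exact ⟨1, 0, by simp [vertex, hij], by simp [vertex, endSign], by simp [vertex, hjk.symm]⟩
    · rw [odd_vertex_m] at hk
      subst hk
      rcases q with ⟨k, t⟩
      exact ⟨1, endSign t, by cases t <;> simp [vertex, hik, endSign],
        by cases t <;> simp [vertex, hjk, endSign], by cases t <;> simp [vertex, endSign]⟩
  | refl φ v hv hlt ih =>
    have hr := Reached.refl φ v hv hlt
    have hs := endSign_mul_self s
    by_cases hφ : φ i = s
    · have hfix : OctVec.refl φ (vertex (i, s)) = vertex (i, s) := refl_vertex hφ
      have ht' : form (vertex (i, s)) v = -1 := by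
        rw [← ht]; conv_rhs => rw [← hfix]
        rw [form_refl_refl]
      obtain ⟨⟨l, q, hq, h1, h2⟩, h3⟩ := ih ht'
      refine ⟨⟨φ :: l, q, hq, ?_, ?_⟩, fun j k hij hik hjk => ?_⟩
      · change OctVec.refl φ (word l _) = _
        rw [h1, hfix]
      · change OctVec.refl φ (word l _) = _
        rw [h2]
      · rw [odd_refl_m, odd_refl_m]
        have step : ∀ c, PythParam c s i j k v → PythParam c s i j k (OctVec.refl φ v) := by
          rintro c ⟨X, Y, hX, hj, hk⟩
          have hh : c * height φ v = endSign (φ j) * (X ^ 2 - Y ^ 2) + endSign (φ k) * (2 * X * Y)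
              - (X ^ 2 + Y ^ 2) := by
            rw [form_vertex] at ht'
            simp only [height, sum_axes _ hij hik hjk, hφ]
            rw [← hX, ← hj, ← hk]
            linear_combination c * ht'
          have hεk := endSign_mul_self (φ k)
          simp only [PythParam, OctVec.refl]
          generalize height φ v = t at *
          generalize endSign (φ k) = ε at *
          rw [hφ]
          -- The reflection acts on the parameters `(X, Y)` by an integral matrix.
          rcases endSign_eq (φ j) with hj' | hj' <;> rw [hj'] at hh ⊢
          · refine ⟨2 * ε * Y - X, Y, ?_, ?_, ?_⟩
            · linear_combination hX - 2 * hh - 2 * c * t * hs - 4 * Y ^ 2 * hεk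
            · linear_combination hj - 2 * hh - 4 * Y ^ 2 * hεk
            · linear_combination hk - 2 * ε * hh - 4 * X * Y * hεk
          · refine ⟨X, 2 * ε * X - Y, ?_, ?_, ?_⟩
            · linear_combination hX - 2 * hh - 2 * c * t * hs - 4 * X ^ 2 * hεk
            · linear_combination hj + 2 * hh + 4 * X ^ 2 * hεk
            · linear_combination hk - 2 * ε * hh - 4 * X * Y * hεk
        exact ⟨fun ho => step 1 ((h3 j k hij hik hjk).1 ho),
          fun ho => step 2 ((h3 j k hij hik hjk).2 ho)⟩
    · -- A vector inside a mirror that does not meet `vertex (i, s)` cannot be tangent to it.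
      exfalso
      have hpos : 0 < height φ (OctVec.refl φ v) := by rw [height_refl]; linarith
      have h2 : 2 ≤ height φ (OctVec.refl φ v) := by
        obtain ⟨a, ha⟩ := hr.even_height φ
        omega
      have hn := hr.one_le_n
      have hf := hr.form_self
      generalize OctVec.refl φ v = u at *
      obtain ⟨j, hij⟩ : ∃ j, i ≠ j := exists_other_axis i
      obtain ⟨k, hik, hjk⟩ := exists_third_axis hij
      rw [form_vertex] at ht
      have hφ' : endSign (φ i) = -endSign s := by
        rw [← endSign_not]; congr 1; revert hφ; cases φ i <;> cases s <;> simp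
      simp only [height, form, sum_axes _ hij hik hjk, hφ'] at h2 hf
      have hr : ∃ r, endSign s * u.m i = r - 1 := ⟨endSign s * u.m i + 1, by ring⟩
      obtain ⟨r, hr⟩ := hr
      have e2 : u.m i * u.m i = (r - 1) ^ 2 := by
        rw [← hr]; linear_combination (-u.m i * u.m i) * hs
      have e3 : u.n = 2 * r - 1 := by linarith
      have hsum : u.m j ^ 2 + u.m k ^ 2 = r ^ 2 := by rw [e2, e3] at hf; linarith
      -- With `r = ±mᵢ + 1`, height at least `2` needs `3 r ≤ ±mⱼ ± mₖ`, but the right-hand side is at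
      -- most `√2 r`.
      have e4 : 3 * r ≤ endSign (φ j) * u.m j + endSign (φ k) * u.m k := by
        rw [e3] at h2; linarith
      have e5 := endSign_mul_self (φ j)
      have e6 := endSign_mul_self (φ k)
      have e7 : (endSign (φ j) * u.m j + endSign (φ k) * u.m k) ^ 2 ≤ 2 * r ^ 2 := by
        have : (endSign (φ j) * u.m j) ^ 2 + (endSign (φ k) * u.m k) ^ 2 = r ^ 2 := by
          linear_combination hsum + u.m j ^ 2 * e5 + u.m k ^ 2 * e6
        nlinarith [sq_nonneg (endSign (φ j) * u.m j - endSign (φ k) * u.m k)]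
      have hr1 : 1 ≤ r := by omega
      nlinarith

end OctVec

/-! ### The Kronecker symbol and reciprocity -/

theorem exists_odd_part {b : ℤ} (hb : b ≠ 0) :
    ∃ v B : ℕ, Odd B ∧ b.natAbs = 2 ^ v * B :=
  Nat.exists_eq_two_pow_mul_odd (Int.natAbs_ne_zero.2 hb)

theorem odd_part_of_emod_eight_eq_six {b : ℤ} {v B : ℕ} (hB : Odd B) (hbB : b.natAbs = 2 ^ v * B)
    (hb : b % 8 = 6) : v = 1 ∧ (b / 2).natAbs = B := by
  rcases v with _ | _ | v
  · rw [Nat.odd_iff] at hB; omega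
  · omega
  · rw [show 2 ^ (v + 1 + 1) * B = 4 * (2 ^ v * B) by ring] at hbB
    omega

theorem kroneckerSymbol_eq {a b : ℤ} {v B : ℕ} (hB : Odd B) (h : b.natAbs = 2 ^ v * B) :
    kroneckerSymbol a b =
      (if a < 0 ∧ b < 0 then -1 else 1) * ZMod.χ₈ a ^ v * jacobiSym a B := by
  have hv : padicValNat 2 b.natAbs = v := by
    rw [h, padicValNat.mul (by positivity) (by rintro rfl; simp at hB), padicValNat.prime_pow,
      padicValNat.eq_zero_of_not_dvd (by rwa [← even_iff_two_dvd, Nat.not_even_iff_odd]), add_zero]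
  have h2 : b.natAbs / 2 ^ v = B := by rw [h]; exact Nat.mul_div_cancel_left _ (by positivity)
  rw [kroneckerSymbol, hv, h2]

theorem kroneckerSymbol_odd_of_pos {a b : ℤ} (ha : 0 < a) (hb : Odd b) :
    kroneckerSymbol a b = jacobiSym a b.natAbs := by
  rw [kroneckerSymbol_eq (v := 0) (Int.natAbs_odd.2 hb) (by simp)]
  simp [ha.le]

/-- Reciprocity for `b ≡ 1` modulo `4`, either sign of `b`, and positive `f`. -/
theorem jacobiSym_natAbs_of_mod_four_one {f b : ℤ} (hf : 0 < f) (hfo : Odd f)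
    (hb : b % 4 = 1) : jacobiSym f b.natAbs = jacobiSym b f.natAbs := by
  have hfn : (f.natAbs : ℤ) = f := Int.natAbs_of_nonneg hf.le
  have hfo' : Odd f.natAbs := Int.natAbs_odd.2 hfo
  rcases le_total 0 b with h | h
  · have hbn : (b.natAbs : ℤ) = b := Int.natAbs_of_nonneg h
    have := jacobiSym.quadratic_reciprocity_one_mod_four (a := b.natAbs) (b := f.natAbs)
      (by omega) hfo'
    rw [hbn, hfn] at this
    exact this.symm
  · have hbn : (b.natAbs : ℤ) = -b := Int.ofNat_natAbs_of_nonpos h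
    have hb3 : b.natAbs % 4 = 3 := by omega
    have hbo : Odd b.natAbs := Nat.odd_iff.2 (by omega)
    have e : jacobiSym b f.natAbs = jacobiSym (-1) f.natAbs * jacobiSym b.natAbs f.natAbs := by
      rw [← jacobiSym.mul_left, hbn]; ring_nf
    rw [e, jacobiSym.at_neg_one hfo']
    rcases (Nat.odd_mod_four_iff.1 (Nat.odd_iff.1 hfo')) with h1 | h3
    · rw [ZMod.χ₄_nat_one_mod_four h1, one_mul,
        jacobiSym.quadratic_reciprocity_one_mod_four' hbo h1, hfn]
    · rw [ZMod.χ₄_nat_three_mod_four h3,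
        jacobiSym.quadratic_reciprocity_three_mod_four hb3 h3, hfn]
      ring

theorem chi_eight_eq_jacobiSym {f : ℤ} (hf : 0 < f) (hfo : Odd f) :
    ZMod.χ₈ f = jacobiSym 2 f.natAbs := by
  rw [jacobiSym.at_two (Int.natAbs_odd.2 hfo)]
  congr 1
  have : ((f.natAbs : ℤ) : ZMod 8) = (f : ZMod 8) := by rw [Int.natAbs_of_nonneg hf.le]
  rw [← this]; simp

theorem chi_eight_of_mod {f : ℤ} {r : ℤ} (h : f ≡ r [ZMOD 8]) : ZMod.χ₈ f = ZMod.χ₈ r := by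
  have := (ZMod.intCast_eq_intCast_iff f r 8).2 h
  rw [show ((f : ℤ) : ZMod 8) = (r : ZMod 8) from this]

theorem jacobiSym_sq_one {a : ℤ} {b : ℕ} (h : IsCoprime a (b : ℤ)) :
    jacobiSym a b * jacobiSym a b = 1 := by
  rw [← sq]; exact jacobiSym.sq_one (Int.isCoprime_iff_gcd_eq_one.1 h)

/-- If `f f'` is a square modulo `B`, the Jacobi symbols of `f` and `f'` agree. -/
theorem jacobiSym_eq_of_mul_eq {f f' U W : ℤ} {B : ℕ} (h : f * f' = U ^ 2 + B * W)
    (hf : IsCoprime f (B : ℤ)) (hf' : IsCoprime f' (B : ℤ)) : jacobiSym f B = jacobiSym f' B := by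
  have hU : IsCoprime U (B : ℤ) := by
    have h1 : IsCoprime (f * f') (B : ℤ) := hf.mul_left hf'
    rw [h] at h1
    exact (IsCoprime.pow_left_iff two_pos).1 ((IsCoprime.add_mul_left_left_iff).1 h1)
  have e : jacobiSym f B * jacobiSym f' B = 1 := by
    rw [← jacobiSym.mul_left, h, jacobiSym.mod_left]
    rw [Int.add_mul_emod_self_left, ← jacobiSym.mod_left, sq, jacobiSym.mul_left,
      jacobiSym_sq_one hU]
  have e2 := jacobiSym_sq_one hf'
  calc jacobiSym f B = jacobiSym f B * (jacobiSym f' B * jacobiSym f' B) := by rw [e2, mul_one]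
    _ = _ := by rw [← mul_assoc, e, one_mul]

theorem OctType.odd_mod {T : OctType} {a : ℤ} (ha : a ≡ T.oddResidue [ZMOD 8]) :
    a % 8 = 3 ∨ a % 8 = 5 := by
  cases T
  · left; exact ha
  · right; exact ha

/-- For the odd entry, `χ₂` is a Jacobi symbol. -/
theorem chiTwo_odd {T : OctType} {a b : ℤ} (ha : a ≡ T.oddResidue [ZMOD 8]) (hab : 0 < a + b) :
    chiTwo T a b = jacobiSym (a + b) a.natAbs := by
  have h := OctType.odd_mod ha
  have ho : Odd a := Int.odd_iff.2 (by omega)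
  rw [← kroneckerSymbol_odd_of_pos hab ho]
  cases T
  · rw [chiTwo, if_neg (by omega), if_neg (by omega)]
  · rfl

/-- The residue of an even curvature, which must be one of the two even residues of the type. -/
def OctType.IsEvenResidue (T : OctType) (b : ℤ) : Prop :=
  b ≡ T.evenResidue₁ [ZMOD 8] ∨ b ≡ T.evenResidue₂ [ZMOD 8]

/-- For a circle of even curvature `b`, the symbol depends on `f = a + b` only through the Jacobi
symbol at the odd part of `b`, since `f` has a fixed residue modulo `8`. -/
theorem exists_chiTwo_even {T : OctType} {b : ℤ} (hb : T.IsEvenResidue b) (hb0 : b ≠ 0) :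
    ∃ (c e : ℤ) (v B : ℕ), (e = 1 ∨ e = -1) ∧ Odd B ∧ b.natAbs = 2 ^ v * B ∧
      ∀ a : ℤ, a ≡ T.oddResidue [ZMOD 8] → 0 < a + b →
        chiTwo T b a = c * jacobiSym (e * (a + b)) B := by
  obtain ⟨v, B, hB, hbB⟩ := exists_odd_part hb0
  cases T
  · rcases hb with hb | hb
    · have hb' : b % 8 = 0 := hb
      refine ⟨(if b < 0 then -1 else 1) * (-1) ^ v, -1, v, B, Or.inr rfl, hB, hbB,
        fun a ha hab => ?_⟩
      have ha' : a % 8 = 3 := ha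
      rw [chiTwo, if_neg (by omega), if_pos hb', kroneckerSymbol_eq hB hbB,
        chi_eight_of_mod (r := 5) (show (-(b + a)) % 8 = 5 % 8 by omega),
        show ZMod.χ₈ ((5 : ℤ) : ZMod 8) = -1 from by decide]
      have : -(b + a) < 0 := by linarith
      simp only [this, true_and]
      ring_nf
    · have hb' : b % 8 = 6 := hb
      have hv := odd_part_of_emod_eight_eq_six hB hbB hb'
      refine ⟨1, 1, v, B, Or.inl rfl, hB, hbB, fun a ha hab => ?_⟩
      rw [chiTwo, if_pos hb', kroneckerSymbol_odd_of_pos (by linarith)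
        (by rw [Int.odd_iff]; omega), hv.2]
      ring_nf
  · have hpos : ∀ a : ℤ, 0 < a + b → ¬ (b + a < 0 ∧ b < 0) := fun a ha h => by linarith [h.1]
    rcases hb with hb | hb
    · have hb' : b % 8 = 4 := hb
      refine ⟨1, 1, v, B, Or.inl rfl, hB, hbB, fun a ha hab => ?_⟩
      have ha' : a % 8 = 5 := ha
      rw [chiTwo, kroneckerSymbol_eq hB hbB, if_neg (hpos a hab),
        chi_eight_of_mod (r := 1) (show (b + a) % 8 = 1 % 8 by omega),
        show ZMod.χ₈ ((1 : ℤ) : ZMod 8) = 1 from by decide]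
      simp [add_comm]
    · have hb' : b % 8 = 6 := hb
      refine ⟨(-1) ^ v, 1, v, B, Or.inl rfl, hB, hbB, fun a ha hab => ?_⟩
      have ha' : a % 8 = 5 := ha
      rw [chiTwo, kroneckerSymbol_eq hB hbB, if_neg (hpos a hab),
        chi_eight_of_mod (r := 3) (show (b + a) % 8 = 3 % 8 by omega),
        show ZMod.χ₈ ((3 : ℤ) : ZMod 8) = -1 from by decide]
      simp [add_comm]

theorem natAbs_dvd_odd_part {b : ℤ} {v B : ℕ} (h : b.natAbs = 2 ^ v * B) : (B : ℤ) ∣ b := by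
  rw [← Int.natCast_dvd.symm]; exact ⟨2 ^ v, by rw [h, mul_comm]⟩

theorem isCoprime_add_iff {a b : ℤ} : IsCoprime (a + b) b ↔ IsCoprime a b := by
  simpa using IsCoprime.add_mul_right_left_iff (x := a) (y := b) (z := 1)

/-- The symbol of an even circle is the same at any two of its odd neighbours. -/
theorem chiTwo_even_const {T : OctType} {a a' b U W : ℤ} (ha : a ≡ T.oddResidue [ZMOD 8])
    (ha' : a' ≡ T.oddResidue [ZMOD 8]) (hb : T.IsEvenResidue b) (hb0 : b ≠ 0)
    (hab : 0 < a + b) (hab' : 0 < a' + b) (hc : IsCoprime a b) (hc' : IsCoprime a' b)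
    (h : (a + b) * (a' + b) = U ^ 2 + b * W) : chiTwo T b a = chiTwo T b a' := by
  obtain ⟨c, e, v, B, he, hB, hbB, hx⟩ := exists_chiTwo_even hb hb0
  have hd := natAbs_dvd_odd_part hbB
  rw [hx a ha hab, hx a' ha' hab', jacobiSym.mul_left, jacobiSym.mul_left e]
  obtain ⟨q, hq⟩ := hd
  rw [jacobiSym_eq_of_mul_eq (U := U) (W := q * W) (by rw [h]; rw [← mul_assoc, ← hq])
    ((isCoprime_add_iff.2 hc).of_isCoprime_of_dvd_right ⟨q, hq⟩)
    ((isCoprime_add_iff.2 hc').of_isCoprime_of_dvd_right ⟨q, hq⟩)]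

theorem ne_zero_of_isCoprime_odd {T : OctType} {a b : ℤ} (ha : a ≡ T.oddResidue [ZMOD 8])
    (hc : IsCoprime a b) : b ≠ 0 := by
  rintro rfl
  have h := OctType.odd_mod ha
  rw [isCoprime_zero_right, Int.isUnit_iff] at hc
  omega

/-- The symbol of an odd circle at two even neighbours of the same colour agrees. -/
theorem chiTwo_odd_const {T : OctType} {a b b' U W : ℤ} (ha : a ≡ T.oddResidue [ZMOD 8])
    (hab : 0 < a + b) (hab' : 0 < a + b') (hc : IsCoprime a b) (hc' : IsCoprime a b')
    (h : (a + b) * (a + b') = U ^ 2 + a * W) : chiTwo T a b = chiTwo T a b' := by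
  rw [chiTwo_odd ha hab, chiTwo_odd ha hab']
  have hd : (a.natAbs : ℤ) ∣ a := Int.natAbs_dvd.2 dvd_rfl
  obtain ⟨q, hq⟩ := hd
  refine jacobiSym_eq_of_mul_eq (U := U) (W := q * W) (by rw [h, ← mul_assoc, ← hq]) ?_ ?_
  · rw [add_comm]; exact (isCoprime_add_iff.2 hc.symm).of_isCoprime_of_dvd_right ⟨q, hq⟩
  · rw [add_comm]; exact (isCoprime_add_iff.2 hc'.symm).of_isCoprime_of_dvd_right ⟨q, hq⟩

/-- The symbol of an odd circle at two even neighbours of different colours is opposite, because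
the Jacobi symbol of `2` at an integer congruent to `±3` modulo `8` is `-1`. -/
theorem chiTwo_odd_neg {T : OctType} {a b b' U W : ℤ} (ha : a ≡ T.oddResidue [ZMOD 8])
    (hab : 0 < a + b) (hab' : 0 < a + b') (hc : IsCoprime a b) (hc' : IsCoprime a b')
    (h : (a + b) * (2 * (a + b')) = U ^ 2 + a * W) : chiTwo T a b = -chiTwo T a b' := by
  rw [chiTwo_odd ha hab, chiTwo_odd ha hab']
  have hm := OctType.odd_mod ha
  have ho : Odd a.natAbs := by rw [Int.natAbs_odd, Int.odd_iff]; omega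
  have hd : (a.natAbs : ℤ) ∣ a := Int.natAbs_dvd.2 dvd_rfl
  have h2 : IsCoprime (2 : ℤ) (a.natAbs : ℤ) := by
    exact_mod_cast Nat.isCoprime_iff_coprime.2 (Nat.coprime_two_left.2 ho)
  obtain ⟨q, hq⟩ := hd
  have e := jacobiSym_eq_of_mul_eq (B := a.natAbs) (U := U) (W := q * W)
    (by rw [h, ← mul_assoc, ← hq])
    (by rw [add_comm]; exact (isCoprime_add_iff.2 hc.symm).of_isCoprime_of_dvd_right ⟨q, hq⟩)
    (h2.mul_left (by
      rw [add_comm]; exact (isCoprime_add_iff.2 hc'.symm).of_isCoprime_of_dvd_right ⟨q, hq⟩))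
  rw [e, jacobiSym.mul_left, jacobiSym.at_two ho]
  have : ZMod.χ₈ (a.natAbs : ZMod 8) = -1 := by
    have h8 : a.natAbs % 8 = 3 ∨ a.natAbs % 8 = 5 := by omega
    rw [ZMod.χ₈_nat_eq_if_mod_eight]
    rw [if_neg (by omega), if_neg (by omega)]
  rw [this]; ring

/-- Symmetry of `χ₂`, a form of quadratic reciprocity. -/
theorem chiTwo_comm {T : OctType} {a b : ℤ} (ha : a ≡ T.oddResidue [ZMOD 8])
    (hb : T.IsEvenResidue b) (hab : 0 < a + b) (hc : IsCoprime a b) :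
    chiTwo T a b = chiTwo T b a := by
  have hb0 := ne_zero_of_isCoprime_odd ha hc
  rw [chiTwo_odd ha hab]
  set f := a + b with hf
  have hba : b + a = f := add_comm b a
  obtain ⟨v, B, hB, hbB⟩ := exists_odd_part hb0
  have hpos : ¬ (f < 0 ∧ b < 0) := fun h => by linarith [h.1]
  have hmod : ∀ x y : ℤ, f ∣ x - y → jacobiSym x f.natAbs = jacobiSym y f.natAbs := by
    intro x y hxy
    apply jacobiSym.mod_left'
    rw [Int.natAbs_of_nonneg hab.le]
    exact Int.emod_eq_emod_iff_emod_sub_eq_zero.2 (Int.emod_eq_zero_of_dvd hxy)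
  cases T
  · have ha' : a % 8 = 3 := ha
    have hfo : Odd f := by
      rcases hb with hb | hb
      · have hb' : b % 8 = 0 := hb
        rw [Int.odd_iff]; omega
      · have hb' : b % 8 = 6 := hb
        rw [Int.odd_iff]; omega
    have e1 : jacobiSym f a.natAbs = jacobiSym b f.natAbs := by
      rw [← Int.natAbs_neg, jacobiSym_natAbs_of_mod_four_one hab hfo (by omega)]
      exact hmod _ _ ⟨-1, by rw [hf]; ring⟩
    rw [e1]
    rcases hb with hb | hb
    · have hb' : b % 8 = 0 := hb
      have hf3 : f % 8 = 3 := by omega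
      rw [chiTwo, if_neg (by omega), if_pos hb', hba, kroneckerSymbol_eq hB hbB]
      have hneg : -f < 0 := by linarith
      have hχ : ZMod.χ₈ ((-f : ℤ) : ZMod 8) = jacobiSym 2 f.natAbs := by
        rw [← chi_eight_eq_jacobiSym hab hfo, chi_eight_of_mod (r := 5)
          (show (-f) % 8 = 5 % 8 by omega), chi_eight_of_mod (r := 3) (show f % 8 = 3 % 8 by omega)]
        decide
      have hfn : f.natAbs % 4 = 3 := by omega
      have hJ : jacobiSym (-f) B = jacobiSym B f.natAbs := by
        rw [show -f = -1 * f by ring, jacobiSym.mul_left, jacobiSym.at_neg_one hB]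
        rcases Nat.odd_mod_four_iff.1 (Nat.odd_iff.1 hB) with h1 | h3
        · rw [ZMod.χ₄_nat_one_mod_four h1, one_mul,
            jacobiSym.quadratic_reciprocity_one_mod_four h1 (Int.natAbs_odd.2 hfo),
            Int.natAbs_of_nonneg hab.le]
        · rw [ZMod.χ₄_nat_three_mod_four h3,
            jacobiSym.quadratic_reciprocity_three_mod_four h3 hfn, Int.natAbs_of_nonneg hab.le]
          ring
      rw [hχ, hJ, ← jacobiSym.pow_left, mul_assoc, ← jacobiSym.mul_left]
      rcases lt_or_ge b 0 with hb1 | hb1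
      · rw [if_pos ⟨hneg, hb1⟩]
        have : b = -1 * (2 ^ v * (B : ℤ)) := by
          have := congrArg (Nat.cast (R := ℤ)) hbB
          push_cast at this
          rw [abs_of_neg hb1] at this
          linarith
        conv_lhs => rw [this]
        rw [jacobiSym.mul_left, jacobiSym.at_neg_one (Int.natAbs_odd.2 hfo),
          ZMod.χ₄_nat_three_mod_four hfn]
      · rw [if_neg (fun h => by linarith [h.2])]
        have : b = 2 ^ v * (B : ℤ) := by
          have := congrArg (Nat.cast (R := ℤ)) hbB
          push_cast at this
          rw [abs_of_nonneg hb1] at this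
          linarith
        conv_lhs => rw [this]
        rw [one_mul]
    · have hb' : b % 8 = 6 := hb
      rw [chiTwo, if_pos hb', hba, kroneckerSymbol_odd_of_pos hab (by rw [Int.odd_iff]; omega)]
      have h1 : f.natAbs % 8 = 1 := by omega
      have e2 : jacobiSym b f.natAbs = jacobiSym (b / 2) f.natAbs := by
        conv_lhs => rw [show b = 2 * (b / 2) by omega]
        rw [jacobiSym.mul_left, jacobiSym.at_two (Int.natAbs_odd.2 hfo),
          ZMod.χ₈_nat_eq_if_mod_eight, if_neg (by omega), if_pos (by omega), one_mul]
      have hneg1 : jacobiSym (-1) f.natAbs = 1 := by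
        rw [jacobiSym.at_neg_one (Int.natAbs_odd.2 hfo), ZMod.χ₄_nat_one_mod_four (by omega)]
      have e3 : jacobiSym (-(b / 2)) f.natAbs = jacobiSym (b / 2) f.natAbs := by
        rw [show -(b / 2) = -1 * (b / 2) by ring, jacobiSym.mul_left, hneg1, one_mul]
      rw [e2]
      rw [← Int.natAbs_neg (b / 2), jacobiSym_natAbs_of_mod_four_one hab hfo (by omega), e3]
  · have ha' : a % 8 = 5 := ha
    have hfo : Odd f := by
      rcases hb with hb | hb
      · have hb' : b % 8 = 4 := hb
        rw [Int.odd_iff]; omega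
      · have hb' : b % 8 = 6 := hb
        rw [Int.odd_iff]; omega
    have e1 : jacobiSym f a.natAbs = jacobiSym (-b) f.natAbs := by
      rw [jacobiSym_natAbs_of_mod_four_one hab hfo (by omega)]
      exact hmod _ _ ⟨1, by rw [hf]; ring⟩
    rw [e1, chiTwo, hba, kroneckerSymbol_eq hB hbB, if_neg hpos, one_mul,
      chi_eight_eq_jacobiSym hab hfo]
    rw [← jacobiSym.pow_left]
    rcases hb with hb | hb
    · have hb' : b % 8 = 4 := hb
      have hneg1 : jacobiSym (-1) f.natAbs = 1 := by
        rw [jacobiSym.at_neg_one (Int.natAbs_odd.2 hfo), ZMod.χ₄_nat_one_mod_four (by omega)]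
      have hJ : jacobiSym f B = jacobiSym B f.natAbs := by
        rw [jacobiSym.quadratic_reciprocity_one_mod_four' hB (b := f.natAbs) (by omega),
          Int.natAbs_of_nonneg hab.le]
      rw [hJ, ← jacobiSym.mul_left]
      have h2 : (2 : ℤ) ^ v * B = b ∨ (2 : ℤ) ^ v * B = -b := by
        have := congrArg (Nat.cast (R := ℤ)) hbB
        push_cast at this
        rw [← this]; exact abs_choice b
      rcases h2 with h2 | h2 <;> rw [h2]
      rw [show -b = -1 * b by ring, jacobiSym.mul_left, hneg1, one_mul]
    · have hb' : b % 8 = 6 := hb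
      have hv := odd_part_of_emod_eight_eq_six hB hbB hb'
      have hJ : jacobiSym f B = jacobiSym (-(b / 2)) f.natAbs := by
        rw [← hv.2, ← Int.natAbs_neg (b / 2),
          jacobiSym_natAbs_of_mod_four_one hab hfo (by omega)]
      rw [hJ, ← jacobiSym.mul_left, hv.1]
      congr 1; omega

/-- A square even curvature has an even power of `2` and a square odd part, so every factor of the
symbol is `1`. -/
theorem chiTwo_even_sq {T : OctType} {a b n : ℤ} (ha : a ≡ T.oddResidue [ZMOD 8])
    (hb : T.IsEvenResidue b) (hc : IsCoprime a b) (hn : b = n ^ 2) :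
    chiTwo T b a = 1 := by
  have hb0 := ne_zero_of_isCoprime_odd ha hc
  have hn0 : n ≠ 0 := by rintro rfl; simp at hn; exact hb0 hn
  obtain ⟨v, B, hB, hnB⟩ := exists_odd_part hn0
  have hbB : b.natAbs = 2 ^ (2 * v) * (B * B) := by
    rw [hn, Int.natAbs_pow, hnB]; ring
  have hm : b % 8 ≠ 6 := by
    rw [hn, sq, Int.mul_emod]
    have h1 := Int.emod_nonneg n (show (8:ℤ) ≠ 0 by norm_num)
    have h2 := Int.emod_lt_of_pos n (show (0:ℤ) < 8 by norm_num)
    interval_cases n % 8 <;> decide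
  have hBo : Odd (B * B) := hB.mul hB
  have hbp : ¬ b < 0 := by rw [hn]; exact not_lt.2 (sq_nonneg n)
  have hcB : ∀ e : ℤ, IsUnit e → IsCoprime (e * (b + a)) (B : ℤ) := by
    intro e he
    have h1 : IsCoprime (b + a) b := by rw [add_comm]; exact isCoprime_add_iff.2 hc
    have h2 : (B : ℤ) ∣ b := (Dvd.intro_left (B : ℤ) (by push_cast; rfl)).trans
      (natAbs_dvd_odd_part hbB)
    exact (isCoprime_mul_unit_left_left he _ _).2 (h1.of_isCoprime_of_dvd_right h2)
  have hχ : ∀ x : ℤ, Odd x → ZMod.χ₈ x ^ (2 * v) = 1 := by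
    intro x hx
    rw [pow_mul, ZMod.χ₈_int_eq_if_mod_eight]
    rw [Int.odd_iff] at hx
    rw [if_neg (by omega)]
    split_ifs <;> simp
  have hJ : ∀ e : ℤ, IsUnit e → jacobiSym (e * (b + a)) (B * B) = 1 := by
    intro e he
    have : NeZero B := ⟨by rintro rfl; simp at hB⟩
    rw [jacobiSym.mul_right, jacobiSym_sq_one (hcB e he)]
  have hao : a % 8 = 3 ∨ a % 8 = 5 := OctType.odd_mod ha
  cases T
  · rcases hb with hb | hb
    · have hb' : b % 8 = 0 := hb
      rw [chiTwo, if_neg (by omega), if_pos hb', kroneckerSymbol_eq hBo hbB,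
        hχ _ (by rw [Int.odd_iff]; omega), show -(b + a) = -1 * (b + a) by ring,
        hJ (-1) (by decide), if_neg (fun h => hbp h.2)]
      rfl
    · exact absurd hb hm
  · rcases hb with hb | hb
    · have hb' : b % 8 = 4 := hb
      rw [chiTwo, kroneckerSymbol_eq hBo hbB,
        hχ _ (by rw [Int.odd_iff]; omega), ← one_mul (b + a),
        hJ 1 isUnit_one, if_neg (fun h => hbp h.2)]
      rfl
    · exact absurd hb hm

/-- Residues leave only `b ≡ 0` modulo `8` in type `(0, 3, 6)`, where `2` divides `b` to an odd power
and the symbol at `2` of `-(a + b) ≡ 5` is `-1`. -/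
theorem chiTwo_even_two_mul_sq {T : OctType} {a b n : ℤ} (ha : a ≡ T.oddResidue [ZMOD 8])
    (hb : T.IsEvenResidue b) (hc : IsCoprime a b) (hn : b = 2 * n ^ 2) :
    chiTwo T b a = -1 := by
  have hb0 := ne_zero_of_isCoprime_odd ha hc
  have hn0 : n ≠ 0 := by rintro rfl; simp at hn; exact hb0 hn
  obtain ⟨v, B, hB, hnB⟩ := exists_odd_part hn0
  have hbB : b.natAbs = 2 ^ (2 * v + 1) * (B * B) := by
    rw [hn, Int.natAbs_mul, Int.natAbs_pow, hnB]
    simp only [Int.reduceAbs]; ring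
  have hm : b % 8 ≠ 6 ∧ b % 8 ≠ 4 := by
    rw [hn, sq, Int.mul_emod, Int.mul_emod n]
    have h1 := Int.emod_nonneg n (show (8:ℤ) ≠ 0 by norm_num)
    have h2 := Int.emod_lt_of_pos n (show (0:ℤ) < 8 by norm_num)
    interval_cases n % 8 <;> decide
  have hBo : Odd (B * B) := hB.mul hB
  have hbp : ¬ b < 0 := by rw [hn]; exact not_lt.2 (by positivity)
  have hcB : IsCoprime (-(b + a)) (B : ℤ) := by
    have h1 : IsCoprime (b + a) b := by rw [add_comm]; exact isCoprime_add_iff.2 hc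
    have h2 : (B : ℤ) ∣ b := (Dvd.intro_left (B : ℤ) (by push_cast; rfl)).trans
      (natAbs_dvd_odd_part hbB)
    exact (h1.of_isCoprime_of_dvd_right h2).neg_left
  have : NeZero B := ⟨by rintro rfl; simp at hB⟩
  cases T
  · rcases hb with hb | hb
    · have hb' : b % 8 = 0 := hb
      have ha' : a % 8 = 3 := ha
      rw [chiTwo, if_neg (by omega), if_pos hb', kroneckerSymbol_eq hBo hbB,
        jacobiSym.mul_right, jacobiSym_sq_one hcB, if_neg (fun h => hbp h.2),
        chi_eight_of_mod (r := 5) (show (-(b + a)) % 8 = 5 % 8 by omega),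
        show ZMod.χ₈ ((5 : ℤ) : ZMod 8) = -1 from by decide]
      simp [pow_succ, pow_mul]
    · exact absurd hb hm.1
  · rcases hb with hb | hb
    · exact absurd hb hm.2
    · exact absurd hb hm.1

/-! ### The curvature functional -/

/-- A sequence of integers that is periodic modulo every prime, and not identically zero modulo any
prime dividing `N`, has a term coprime to `N`. -/
theorem exists_isCoprime_of_forall_prime {F : ℕ → ℤ}
    (hF : ∀ p m n : ℕ, m ≡ n [MOD p] → F m ≡ F n [ZMOD p]) {N : ℤ} (hN : N ≠ 0)
    (h : ∀ p : ℕ, p.Prime → (p : ℤ) ∣ N → ∃ n, ¬ (p : ℤ) ∣ F n) : ∃ n, IsCoprime (F n) N := by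
  classical
  have h' : ∀ p : ℕ, ∃ n, p.Prime → (p : ℤ) ∣ N → ¬ (p : ℤ) ∣ F n := by
    intro p
    by_cases hp : p.Prime ∧ (p : ℤ) ∣ N
    · obtain ⟨n, hn⟩ := h p hp.1 hp.2
      exact ⟨n, fun _ _ => hn⟩
    · exact ⟨0, fun h1 h2 => absurd ⟨h1, h2⟩ hp⟩
  choose a ha using h'
  obtain ⟨n, hn⟩ := Nat.chineseRemainderOfFinset a id N.natAbs.primeFactors
    (fun p hp => (Nat.prime_of_mem_primeFactors hp).ne_zero)
    (fun p hp q hq hpq => (Nat.coprime_primes (Nat.prime_of_mem_primeFactors hp)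
      (Nat.prime_of_mem_primeFactors hq)).2 hpq)
  refine ⟨n, ?_⟩
  rw [Int.isCoprime_iff_gcd_eq_one, Int.gcd_eq_natAbs]
  by_contra hg
  obtain ⟨p, hp, hd⟩ := Nat.exists_prime_and_dvd hg
  have h1 : (p : ℤ) ∣ F n := Int.natCast_dvd.2 (hd.trans (Nat.gcd_dvd_left _ _))
  have h2 : p ∣ N.natAbs := hd.trans (Nat.gcd_dvd_right _ _)
  have hmem : p ∈ N.natAbs.primeFactors :=
    Nat.mem_primeFactors.2 ⟨hp, h2, Int.natAbs_ne_zero.2 hN⟩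
  have h3 := hF p n (a p) (hn p hmem)
  exact ha p hp (Int.natCast_dvd.2 h2) ((Int.ModEq.dvd_iff h3).1 h1)

/-- A linear functional on the lattice, given by its values `s` on `w` and `xᵢ` on `uᵢ`.  For the
curvature functional, the curvatures of the base circles on the axis `i` are `s + xᵢ` and
`s - xᵢ`. -/
structure CurvData where
  s : ℤ
  x : Fin 3 → ℤ

namespace CurvData

open OctVec

/-- The value of the functional at a lattice vector. -/
def eval (Q : CurvData) (v : OctVec) : ℤ := Q.s * v.n + ∑ i, Q.x i * v.m i

/-- The functional precomposed with the reflection of the face `φ`. -/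
def step (φ : OctFace) (Q : CurvData) : CurvData where
  s := Q.s + (4 * Q.s + 2 * ∑ i, endSign (φ i) * Q.x i)
  x i := Q.x i - (4 * Q.s + 2 * ∑ i, endSign (φ i) * Q.x i) * endSign (φ i)

/-- The functional precomposed with the product of the reflections of a list of faces. -/
def move (l : List OctFace) (Q : CurvData) : CurvData := l.foldl (fun Q φ => step φ Q) Q

theorem eval_step (φ : OctFace) (Q : CurvData) (v : OctVec) :
    eval (step φ Q) v = eval Q (refl φ v) := by
  simp only [eval, step, OctVec.refl, height, Fin.sum_univ_three]
  ring

theorem eval_move (l : List OctFace) (Q : CurvData) (v : OctVec) :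
    eval (move l Q) v = eval Q (word l v) := by
  induction l generalizing Q with
  | nil => rfl
  | cons φ l ih => exact (ih (step φ Q)).trans (eval_step φ Q _)

theorem eval_vertex (Q : CurvData) (i : Fin 3) (s : Bool) :
    eval Q (vertex (i, s)) = Q.s + endSign s * Q.x i := by
  simp [eval, vertex, mul_comm]

/-- The properties of the curvature functional of a primitive packing of type `T` with odd
axis `i`, as seen from any configuration of the packing: it is future directed and null, has the
residues prescribed by the type, and is primitive away from `2`. -/
structure Admissible (T : OctType) (i : Fin 3) (Q : CurvData) : Prop where
  pos : 0 < Q.s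
  null : ∑ j, Q.x j ^ 2 = 2 * Q.s ^ 2
  odd : ∀ s : Bool, Q.s + endSign s * Q.x i ≡ T.oddResidue [ZMOD 8]
  even : ∀ j, j ≠ i → ∃ s : Bool, Q.s + endSign s * Q.x j ≡ T.evenResidue₁ [ZMOD 8] ∧
    Q.s + endSign (!s) * Q.x j ≡ T.evenResidue₂ [ZMOD 8]
  prim : ∀ p : ℕ, p.Prime → p ≠ 2 → (p : ℤ) ∣ Q.s → ¬ ∀ j, (p : ℤ) ∣ Q.x j

variable {T : OctType} {i : Fin 3} {Q : CurvData}

theorem Admissible.isEvenResidue (h : Admissible T i Q) {j : Fin 3} (hj : j ≠ i) (t : Bool) :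
    T.IsEvenResidue (Q.s + endSign t * Q.x j) := by
  obtain ⟨s, h1, h2⟩ := h.even j hj
  by_cases hs : t = s
  · subst hs; exact Or.inl h1
  · have : t = !s := by cases t <;> cases s <;> simp at hs ⊢
    subst this; exact Or.inr h2

theorem even_of_isEvenResidue {b : ℤ} (h : T.IsEvenResidue b) : Even b := by
  rw [Int.even_iff]
  have h' : b % 8 = 0 ∨ b % 8 = 4 ∨ b % 8 = 6 := by
    cases T
    · rcases h with h | h
      · exact Or.inl h
      · exact Or.inr (Or.inr h)
    · rcases h with h | h
      · exact Or.inr (Or.inl h)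
      · exact Or.inr (Or.inr h)
  omega

theorem Admissible.step (h : Admissible T i Q) (φ : OctFace) : Admissible T i (step φ Q) := by
  obtain ⟨t, ht⟩ : ∃ t, t = 4 * Q.s + 2 * ∑ i, endSign (φ i) * Q.x i := ⟨_, rfl⟩
  have es : (CurvData.step φ Q).s = Q.s + t := by rw [ht]; rfl
  have ex : ∀ j, (CurvData.step φ Q).x j = Q.x j - t * endSign (φ j) := by
    intro j; rw [ht]; rfl
  have e0 := endSign_mul_self (φ 0)
  have e1 := endSign_mul_self (φ 1)
  have e2 := endSign_mul_self (φ 2)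
  have hnull := h.null
  -- `t` is divisible by `4`, so the curvatures do not change modulo `8`.
  have h4 : ∃ c, t = 4 * c := by
    obtain ⟨j, hij⟩ : ∃ j, i ≠ j := exists_other_axis i
    obtain ⟨k, hik, hjk⟩ := exists_third_axis hij
    have h1 := OctType.odd_mod (h.odd (φ i))
    have h1' := OctType.odd_mod (h.odd (!φ i))
    have h11 : Q.s + endSign (!φ i) * Q.x i ≡ Q.s + endSign (φ i) * Q.x i [ZMOD 8] :=
      (h.odd _).trans (h.odd _).symm
    have h2 := Int.even_iff.1 (even_of_isEvenResidue (h.isEvenResidue hij.symm (φ j)))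
    have h3 := Int.even_iff.1 (even_of_isEvenResidue (h.isEvenResidue hik.symm (φ k)))
    rw [endSign_not] at h1' h11
    rw [ht, sum_axes _ hij hik hjk]
    have h11' : (Q.s + -endSign (φ i) * Q.x i) % 8 = (Q.s + endSign (φ i) * Q.x i) % 8 := h11
    rw [neg_mul] at h1' h11'
    generalize endSign (φ i) * Q.x i = y1 at *
    generalize endSign (φ j) * Q.x j = y2 at *
    generalize endSign (φ k) * Q.x k = y3 at *
    exact ⟨(4 * Q.s + 2 * (y1 + y2 + y3)) / 4, by omega⟩
  obtain ⟨c, hc⟩ := h4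
  have hmod : ∀ s j, Q.s + t + endSign s * (Q.x j - t * endSign (φ j)) ≡
      Q.s + endSign s * Q.x j [ZMOD 8] := by
    intro s j
    rw [hc]
    apply Int.ModEq.symm
    rw [Int.modEq_iff_dvd]
    cases s <;> cases φ j <;> simp only [endSign, if_true, if_false, Bool.false_eq_true]
    · exact ⟨0, by ring⟩
    · exact ⟨c, by ring⟩
    · exact ⟨c, by ring⟩
    · exact ⟨0, by ring⟩
  simp only [Fin.sum_univ_three] at ht hnull
  refine ⟨?_, ?_, fun s => ?_, fun j hj => ?_, fun p hp hp2 hs hx => ?_⟩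
  · rw [es]
    have hp := h.pos
    obtain ⟨y, hy⟩ : ∃ y, y = endSign (φ 0) * Q.x 0 + endSign (φ 1) * Q.x 1 +
      endSign (φ 2) * Q.x 2 := ⟨_, rfl⟩
    have hy2 : y ^ 2 ≤ 6 * Q.s ^ 2 := by
      have hsq : (endSign (φ 0) * Q.x 0) ^ 2 + (endSign (φ 1) * Q.x 1) ^ 2 +
          (endSign (φ 2) * Q.x 2) ^ 2 = 2 * Q.s ^ 2 := by
        linear_combination hnull + Q.x 0 ^ 2 * e0 + Q.x 1 ^ 2 * e1 + Q.x 2 ^ 2 * e2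
      rw [hy]
      nlinarith [sq_nonneg (endSign (φ 0) * Q.x 0 - endSign (φ 1) * Q.x 1),
        sq_nonneg (endSign (φ 0) * Q.x 0 - endSign (φ 2) * Q.x 2),
        sq_nonneg (endSign (φ 1) * Q.x 1 - endSign (φ 2) * Q.x 2)]
    rw [ht, ← hy]
    by_contra! hc
    nlinarith
  · simp only [Fin.sum_univ_three, es, ex]
    linear_combination hnull + t ^ 2 * (e0 + e1 + e2) + t * ht
  · rw [es, ex]; exact (hmod s i).trans (h.odd s)
  · obtain ⟨s, h1, h2⟩ := h.even j hj
    refine ⟨s, ?_, ?_⟩ <;> rw [es, ex]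
    · exact (hmod _ j).trans h1
    · exact (hmod _ j).trans h2
  · have ht' : (p : ℤ) ∣ t := by
      have : -t = 4 * (CurvData.step φ Q).s + 2 * (endSign (φ 0) * (CurvData.step φ Q).x 0 +
          endSign (φ 1) * (CurvData.step φ Q).x 1 + endSign (φ 2) * (CurvData.step φ Q).x 2) := by
        rw [es, ex, ex, ex]
        linear_combination ht + 2 * t * (e0 + e1 + e2)
      rw [← dvd_neg, this]
      exact dvd_add (hs.mul_left _) (((((hx 0).mul_left _).add ((hx 1).mul_left _)).add
        ((hx 2).mul_left _)).mul_left _)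
    refine h.prim p hp hp2 ?_ fun j => ?_
    · rw [es] at hs; exact (dvd_add_left ht').1 hs
    · have := hx j
      rw [ex] at this
      exact (dvd_sub_left (ht'.mul_right _)).1 this

theorem Admissible.move (h : Admissible T i Q) (l : List OctFace) : Admissible T i (move l Q) := by
  induction l generalizing Q with
  | nil => exact h
  | cons φ l ih => exact ih (h.step φ)

/-- Sums of curvatures of tangent circles are nonnegative: they are the values of the future
directed null functional at light-like vectors. -/
theorem Admissible.add_nonneg (h : Admissible T i Q) {j k : Fin 3} (hjk : j ≠ k) (s t : Bool) :
    0 ≤ Q.s + endSign s * Q.x j + (Q.s + endSign t * Q.x k) := by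
  obtain ⟨l, hjl, hkl⟩ := exists_third_axis hjk
  have hn := h.null
  rw [sum_axes _ hjk hjl hkl] at hn
  have hp := h.pos
  have e1 : (endSign s * Q.x j) ^ 2 = Q.x j ^ 2 := by
    linear_combination Q.x j ^ 2 * endSign_mul_self s
  have e2 : (endSign t * Q.x k) ^ 2 = Q.x k ^ 2 := by
    linear_combination Q.x k ^ 2 * endSign_mul_self t
  generalize endSign s * Q.x j = y at *
  generalize endSign t * Q.x k = z at *
  by_contra! hc
  nlinarith [sq_nonneg (y - z), sq_nonneg (Q.x l)]

theorem Admissible.add_pos (h : Admissible T i Q) {j : Fin 3} (hj : j ≠ i) (s t : Bool) :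
    0 < Q.s + endSign s * Q.x i + (Q.s + endSign t * Q.x j) := by
  have h0 := h.add_nonneg hj.symm s t
  have h1 := OctType.odd_mod (h.odd s)
  have h2 := Int.even_iff.1 (even_of_isEvenResidue (h.isEvenResidue hj t))
  generalize endSign s * Q.x i = y at *
  generalize endSign t * Q.x j = z at *
  omega

/-- The sum of the curvatures of `vertex (i, s)` and a neighbour is a value of a binary
quadratic form at the Pythagorean parameters. -/
theorem add_eval_of_pythParam {s : Bool} {i j k : Fin 3} (hij : i ≠ j) (hik : i ≠ k)
    (hjk : j ≠ k) {v : OctVec} (ht : form (vertex (i, s)) v = -1) {c : ℤ}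
    (h : PythParam c s i j k v) : ∃ X Y : ℤ, c * (eval Q (vertex (i, s)) + eval Q v) =
      (2 * Q.s + endSign s * Q.x i + Q.x j) * X ^ 2 + 2 * Q.x k * X * Y +
      (2 * Q.s + endSign s * Q.x i - Q.x j) * Y ^ 2 := by
  obtain ⟨X, Y, h1, h2, h3⟩ := h
  refine ⟨X, Y, ?_⟩
  rw [form_vertex] at ht
  rw [eval_vertex, eval, sum_axes _ hij hik hjk]
  have hs := endSign_mul_self s
  linear_combination (-Q.s * c) * ht + (2 * Q.s + endSign s * Q.x i) * h1 + Q.x j * h2 +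
    Q.x k * h3 - c * Q.x i * v.m i * hs

/-- The form attached to a circle of curvature `a` has discriminant `-8 a²`, so a product of two of
its values is a square modulo `a`. -/
theorem exists_mul_eq_of_pythParam (hn : ∑ j, Q.x j ^ 2 = 2 * Q.s ^ 2) {s : Bool} {i j k : Fin 3}
    (hij : i ≠ j) (hik : i ≠ k) (hjk : j ≠ k) {v v' : OctVec}
    (ht : form (vertex (i, s)) v = -1) (ht' : form (vertex (i, s)) v' = -1) {c c' : ℤ}
    (h : PythParam c s i j k v) (h' : PythParam c' s i j k v') :
    ∃ U W : ℤ, c * (eval Q (vertex (i, s)) + eval Q v) * (c' * (eval Q (vertex (i, s)) + eval Q v'))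
      = U ^ 2 + eval Q (vertex (i, s)) * W := by
  obtain ⟨X, Y, e⟩ := add_eval_of_pythParam (Q := Q) hij hik hjk ht h
  obtain ⟨X', Y', e'⟩ := add_eval_of_pythParam (Q := Q) hij hik hjk ht' h'
  rw [e, e', eval_vertex]
  rw [sum_axes _ hij hik hjk] at hn
  have hs := endSign_mul_self s
  refine ⟨(2 * Q.s + endSign s * Q.x i + Q.x j) * X * X' + Q.x k * (X * Y' + X' * Y) +
      (2 * Q.s + endSign s * Q.x i - Q.x j) * Y * Y',
    2 * (Q.s + endSign s * Q.x i) * (X * Y' - X' * Y) ^ 2, ?_⟩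
  linear_combination (-(X * Y' - X' * Y) ^ 2) * (hn + Q.x i ^ 2 * hs)

/-- The circles tangent to two given tangent circles of a configuration include a sequence whose
curvatures are a quadratic polynomial in the index. -/
theorem exists_word_eval_eq (Q : CurvData) {p q : OctVertex} {k : Fin 3} (hpq : p.1 ≠ q.1)
    (hpk : p.1 ≠ k) (hqk : q.1 ≠ k) (n : ℕ) :
    ∃ l t, word l (vertex p) = vertex p ∧ word l (vertex q) = vertex q ∧
      eval Q (word l (vertex (k, t))) = Q.s - Q.x k + 2 * n * Q.x k +
        2 * n * (n - 1) * (eval Q (vertex p) + eval Q (vertex q)) ∧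
      eval Q (word l (vertex (k, !t))) = Q.s - Q.x k + 2 * (n + 1) * Q.x k +
        2 * (n + 1) * n * (eval Q (vertex p) + eval Q (vertex q)) := by
  induction n with
  | zero =>
    refine ⟨[], false, rfl, rfl, ?_, ?_⟩
    · change eval Q (vertex (k, false)) = _
      rw [eval_vertex]; simp [endSign]; ring
    · change eval Q (vertex (k, true)) = _
      rw [eval_vertex]; simp [endSign]; ring
  | succ n ih =>
    obtain ⟨l, t, h1, h2, h3, h4⟩ := ih
    obtain ⟨φ, hp, hq, hk⟩ : ∃ φ : OctFace, φ p.1 = p.2 ∧ φ q.1 = q.2 ∧ φ k = !t :=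
      ⟨fun l => if l = p.1 then p.2 else if l = q.1 then q.2 else !t,
        by simp, by simp [hpq.symm], by simp [hpk.symm, hqk.symm]⟩
    refine ⟨l ++ [φ], !t, ?_, ?_, ?_, ?_⟩
    · rw [word_concat, refl_vertex hp, h1]
    · rw [word_concat, refl_vertex hq, h2]
    · rw [word_concat, refl_vertex (p := (k, !t)) hk, h4]; push_cast; ring
    · rw [word_concat, Bool.not_not, ← eval_move, ← eval_step]
      -- Consecutive curvatures satisfy `c (n + 2) = 2 c (n + 1) - c n + 4 (a + b)`.
      rw [← h1, ← h2] at h3 h4 ⊢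
      rw [← eval_move] at h3 h4 ⊢
      rw [show p = (p.1, p.2) from rfl, show q = (q.1, q.2) from rfl] at *
      simp only [← eval_move] at h3 h4 ⊢
      simp only [eval_vertex, endSign_not] at h3 h4 ⊢
      generalize CurvData.move l Q = R at *
      simp only [CurvData.step, sum_axes _ hpq hpk hqk, hp, hq, hk, endSign_not]
      have ht := endSign_mul_self t
      push_cast
      linear_combination 2 * h4 - h3 +
        (4 * R.s + 2 * (endSign p.2 * R.x p.1 + endSign q.2 * R.x q.1 - endSign t * R.x k)) * ht

/-- Among the circles tangent to two given tangent circles, one has curvature coprime to `N`: by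
primitivity, an odd prime cannot divide all terms of the sequence of curvatures. -/
theorem Admissible.exists_isCoprime (h : Admissible T i Q) {p q : OctVertex} {k : Fin 3}
    (hpq : p.1 ≠ q.1) (hpk : p.1 ≠ k) (hqk : q.1 ≠ k) {N : ℤ} (hN : N ≠ 0)
    (hodd : k = i ∨ Odd N) :
    ∃ l t, word l (vertex p) = vertex p ∧ word l (vertex q) = vertex q ∧
      IsCoprime (eval Q (word l (vertex (k, t)))) N := by
  let F : ℕ → ℤ := fun n => Q.s - Q.x k + 2 * n * Q.x k +
        2 * n * (n - 1) * (eval Q (vertex p) + eval Q (vertex q))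
  have key : ∃ n, IsCoprime (F n) N := by
    apply exists_isCoprime_of_forall_prime _ hN
    · intro r hr hrN
      by_cases hr2 : r = 2
      · subst hr2
        rcases hodd with rfl | hodd
        · obtain ⟨l, t, -, -, h3, -⟩ := exists_word_eval_eq Q hpq hpk hqk 0
          have h5 := OctType.odd_mod ((h.move l).odd t)
          rw [← eval_vertex, eval_move, h3] at h5
          refine ⟨0, ?_⟩
          simp only [F]
          generalize Q.s - Q.x k + 2 * ((0 : ℕ) : ℤ) * Q.x k +
            2 * ((0 : ℕ) : ℤ) * (((0 : ℕ) : ℤ) - 1) * (eval Q (vertex p) + eval Q (vertex q)) = z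
            at *
          push_cast
          omega
        · exact absurd (even_iff_two_dvd.2 hrN) (Int.not_even_iff_odd.2 hodd)
      · by_contra! hall
        have hrp : Prime (r : ℤ) := Nat.prime_iff_prime_int.1 hr
        have hr2' : ¬ (r : ℤ) ∣ 2 := by
          intro hd
          have : r ∣ 2 := by exact_mod_cast hd
          exact hr2 ((Nat.prime_dvd_prime_iff_eq hr Nat.prime_two).1 this)
        have h0 := hall 0
        have h1 := hall 1
        have h2 := hall 2
        simp only [F] at h0 h1 h2
        have hx : (r : ℤ) ∣ Q.x k := by
          have := dvd_sub h1 h0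
          push_cast at this
          ring_nf at this
          rw [mul_comm] at this
          exact (hrp.dvd_or_dvd this).resolve_left hr2'
        have hs : (r : ℤ) ∣ Q.s := by
          have := dvd_add h0 hx
          push_cast at this
          ring_nf at this
          exact this
        have hab : (r : ℤ) ∣ eval Q (vertex p) + eval Q (vertex q) := by
          have : (r : ℤ) ∣ 2 * (2 * (eval Q (vertex p) + eval Q (vertex q))) := by
            have := dvd_sub h2 ((hs.add (hx.mul_left 3)))
            push_cast at this
            ring_nf at this ⊢
            exact this
          exact (hrp.dvd_or_dvd ((hrp.dvd_or_dvd this).resolve_left hr2')).resolve_left hr2'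
        have hn := h.null
        rw [sum_axes _ hpq hpk hqk] at hn
        rw [show p = (p.1, p.2) from rfl, show q = (q.1, q.2) from rfl, eval_vertex,
          eval_vertex] at hab
        have hpp := endSign_mul_self p.2
        have hqq := endSign_mul_self q.2
        have hsum : (r : ℤ) ∣ endSign p.2 * Q.x p.1 + endSign q.2 * Q.x q.1 := by
          have := dvd_sub hab (hs.mul_left 2)
          ring_nf at this ⊢
          exact this
        have hp1 : (r : ℤ) ∣ Q.x p.1 := by
          have : (r : ℤ) ∣ 2 * Q.x p.1 ^ 2 := by
            have e : 2 * Q.x p.1 ^ 2 = 2 * Q.s * Q.s - Q.x k * Q.x k +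
                (endSign p.2 * Q.x p.1 - endSign q.2 * Q.x q.1) *
                (endSign p.2 * Q.x p.1 + endSign q.2 * Q.x q.1) := by
              linear_combination hn - Q.x p.1 ^ 2 * hpp + Q.x q.1 ^ 2 * hqq
            rw [e]
            exact ((hs.mul_left _).sub (hx.mul_left _)).add (hsum.mul_left _)
          exact hrp.dvd_of_dvd_pow ((hrp.dvd_or_dvd this).resolve_left hr2')
        have hq1 : (r : ℤ) ∣ Q.x q.1 := by
          have e : Q.x q.1 = endSign q.2 * (endSign p.2 * Q.x p.1 + endSign q.2 * Q.x q.1) -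
              endSign q.2 * endSign p.2 * Q.x p.1 := by
            linear_combination -Q.x q.1 * hqq
          rw [e]
          exact (hsum.mul_left _).sub (hp1.mul_left _)
        refine h.prim r hr hr2 hs fun j => ?_
        rcases axis_cases hpq hpk hqk j with rfl | rfl | rfl <;> assumption
    · intro r m n hmn
      have : (m : ℤ) ≡ n [ZMOD r] := (Int.natCast_modEq_iff).2 hmn
      simp only [F]
      gcongr
  obtain ⟨n, hn⟩ := key
  obtain ⟨l, t, h1, h2, h3, -⟩ := exists_word_eval_eq Q hpq hpk hqk n
  exact ⟨l, t, h1, h2, by rw [h3]; exact hn⟩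

end CurvData

/-! ### Constancy of the symbol -/

namespace OctVec

/-- Every vector of the orbit has exactly one odd coordinate: its axis. -/
theorem Reached.exists_axis {v : OctVec} (h : Reached v) : ∃ j, ∀ l, Odd (v.m l) ↔ l = j := by
  obtain ⟨l, p, rfl⟩ := h.exists_word
  exact ⟨p.1, fun k => (odd_word_m l _ k).trans (odd_vertex_m p k)⟩

theorem reached_word_vertex (l : List OctFace) (p : OctVertex) : Reached (word l (vertex p)) :=
  (Reached.vertex p).word_mem l

/-- Two tangent vectors of the orbit belong to a common configuration. -/
theorem exists_common_word {C D : OctVec} (hC : Reached C) (hD : Reached D)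
    (h : form C D = -1) : ∃ l p q, p.1 ≠ q.1 ∧ C = word l (vertex p) ∧ D = word l (vertex q) := by
  obtain ⟨l, p, rfl⟩ := hC.exists_word
  have h1 : form (vertex p) (word l.reverse D) = -1 := by
    rw [← h, ← form_word_word l (vertex p), word_word_reverse]
  obtain ⟨⟨l', q, hq, h2, h3⟩, -⟩ := tangent_vertex_structure (hD.word_mem l.reverse)
    (i := p.1) (s := p.2) h1
  refine ⟨l ++ l', p, q, hq.symm, ?_, ?_⟩
  · rw [word_append, h2]
  · rw [word_append, h3, word_word_reverse]

end OctVec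

namespace CurvData

open OctVec

variable {T : OctType} {i : Fin 3} {Q : CurvData}

theorem Admissible.exists_mul_eq (h : Admissible T i Q) {C D D' : OctVec} (hC : Reached C)
    (hD : Reached D) (hD' : Reached D') (hCD : form C D = -1) (hCD' : form C D' = -1)
    {j k l : Fin 3} (hjk : j ≠ k) (hjl : j ≠ l) (hkl : k ≠ l) (hj : Odd (C.m j))
    (hk : Odd (D.m k)) :
    (Odd (D'.m k) → ∃ U W : ℤ,
      (eval Q C + eval Q D) * (eval Q C + eval Q D') = U ^ 2 + eval Q C * W) ∧
    (Odd (D'.m l) → ∃ U W : ℤ,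
      (eval Q C + eval Q D) * (2 * (eval Q C + eval Q D')) = U ^ 2 + eval Q C * W) := by
  obtain ⟨w, p, rfl⟩ := hC.exists_word
  rw [odd_word_m, odd_vertex_m] at hj
  subst hj
  have tr : ∀ E, form (word w (vertex p)) E = -1 → form (vertex p) (word w.reverse E) = -1 := by
    intro E hE
    rw [← hE, ← form_word_word w (vertex p), word_word_reverse]
  have ev : ∀ E, eval Q E = eval (CurvData.move w Q) (word w.reverse E) := by
    intro E; rw [eval_move, word_word_reverse]
  rw [ev D, ev D', ← eval_move]
  have hn := (h.move w).null
  have h1 := (tangent_vertex_structure (hD.word_mem w.reverse) (i := p.1) (s := p.2)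
    (tr D hCD)).2 k l hjk hjl hkl
  have h2 := (tangent_vertex_structure (hD'.word_mem w.reverse) (i := p.1) (s := p.2)
    (tr D' hCD')).2 k l hjk hjl hkl
  rw [odd_word_m, odd_word_m] at h1 h2
  have hP := h1.1 hk
  refine ⟨fun hk' => ?_, fun hl' => ?_⟩
  · obtain ⟨U, W, e⟩ := exists_mul_eq_of_pythParam hn hjk hjl hkl (tr D hCD) (tr D' hCD') hP
      (h2.1 hk')
    exact ⟨U, W, by rw [← e]; simp⟩
  · obtain ⟨U, W, e⟩ := exists_mul_eq_of_pythParam hn hjk hjl hkl (tr D hCD) (tr D' hCD') hP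
      (h2.2 hl')
    exact ⟨U, W, by rw [← e]; simp⟩

/-- A pair of tangent vectors of the orbit with coprime curvatures, the first on the odd axis
`i`. -/
structure CoprimePair (i : Fin 3) (Q : CurvData) (C D : OctVec) : Prop where
  left : Reached C
  right : Reached D
  tangent : form C D = -1
  odd : Odd (C.m i)
  coprime : IsCoprime (eval Q C) (eval Q D)

theorem Admissible.residues (h : Admissible T i Q) {C D : OctVec} (hC : Reached C)
    (hD : Reached D) (ht : form C D = -1) (hi : Odd (C.m i)) :
    eval Q C ≡ T.oddResidue [ZMOD 8] ∧ T.IsEvenResidue (eval Q D) ∧ 0 < eval Q C + eval Q D ∧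
      ∃ j, j ≠ i ∧ Odd (D.m j) := by
  obtain ⟨l, ⟨p, s⟩, ⟨q, t⟩, hpq, rfl, rfl⟩ := exists_common_word hC hD ht
  rw [odd_word_m, odd_vertex_m] at hi
  change i = p at hi
  subst hi
  rw [← eval_move, ← eval_move, eval_vertex, eval_vertex]
  have h' := h.move l
  exact ⟨h'.odd s, h'.isEvenResidue (Ne.symm hpq) t, h'.add_pos (Ne.symm hpq) s t, q, Ne.symm hpq,
    (odd_word_m _ _ _).2 ((odd_vertex_m _ _).2 rfl)⟩

/-- The symbol of a pair, corrected by the sign `-1` unless the even circle lies on the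
axis `j`. -/
def signedChi (T : OctType) (Q : CurvData) (j : Fin 3) (C D : OctVec) : ℤ :=
  (if D.m j % 2 = 1 then 1 else -1) * chiTwo T (eval Q C) (eval Q D)

theorem Admissible.signedChi_eq_of_left (h : Admissible T i Q) {j : Fin 3} (hj : j ≠ i)
    {C D D' : OctVec} (h1 : CoprimePair i Q C D) (h2 : CoprimePair i Q C D') :
    signedChi T Q j C D = signedChi T Q j C D' := by
  obtain ⟨ha, -, hp, a, hai, hao⟩ := h.residues h1.left h1.right h1.tangent h1.odd
  obtain ⟨-, -, hp', b, hbi, hbo⟩ := h.residues h2.left h2.right h2.tangent h2.odd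
  obtain ⟨x, hx⟩ := h1.right.exists_axis
  obtain ⟨y, hy⟩ := h2.right.exists_axis
  obtain rfl := (hx a).1 hao
  obtain rfl := (hy b).1 hbo
  have key : (a = b → chiTwo T (eval Q C) (eval Q D) = chiTwo T (eval Q C) (eval Q D')) ∧
      (a ≠ b → chiTwo T (eval Q C) (eval Q D) = -chiTwo T (eval Q C) (eval Q D')) := by
    constructor
    · rintro rfl
      obtain ⟨c, hac, hic⟩ := exists_third_axis hai
      obtain ⟨U, W, e⟩ := (h.exists_mul_eq h1.left h1.right h2.right h1.tangent h2.tangent hai.symm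
        hic hac h1.odd hao).1 hbo
      exact chiTwo_odd_const ha hp hp' h1.coprime h2.coprime e
    · intro hab
      obtain ⟨U, W, e⟩ := (h.exists_mul_eq h1.left h1.right h2.right h1.tangent h2.tangent hai.symm
        hbi.symm hab h1.odd hao).2 hbo
      exact chiTwo_odd_neg ha hp hp' h1.coprime h2.coprime e
  simp only [signedChi, ← Int.odd_iff, hx, hy]
  by_cases hab : a = b
  · rw [key.1 hab, hab]
  · rw [key.2 hab]
    obtain ⟨c, hjc, hic⟩ := exists_third_axis hj
    rcases axis_cases hj hjc hic a with rfl | rfl | rfl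
    · rw [if_pos rfl, if_neg hab]; ring
    · exact absurd rfl hai
    · rcases axis_cases hj hjc hic b with rfl | rfl | rfl
      · rw [if_pos rfl, if_neg hjc]; ring
      · exact absurd rfl hbi
      · exact absurd rfl hab

theorem Admissible.chiTwo_comm (h : Admissible T i Q) {C D : OctVec} (h1 : CoprimePair i Q C D) :
    chiTwo T (eval Q C) (eval Q D) = chiTwo T (eval Q D) (eval Q C) := by
  obtain ⟨ha, hb, hp, -⟩ := h.residues h1.left h1.right h1.tangent h1.odd
  exact _root_.chiTwo_comm ha hb hp h1.coprime

theorem Admissible.signedChi_eq_of_right (h : Admissible T i Q) (j : Fin 3)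
    {C C' D : OctVec} (h1 : CoprimePair i Q C D) (h2 : CoprimePair i Q C' D) :
    signedChi T Q j C D = signedChi T Q j C' D := by
  obtain ⟨ha, hb, hp, a, hai, hao⟩ := h.residues h1.left h1.right h1.tangent h1.odd
  obtain ⟨ha', -, hp', -⟩ := h.residues h2.left h2.right h2.tangent h2.odd
  simp only [signedChi, h.chiTwo_comm h1, h.chiTwo_comm h2]
  obtain ⟨c, hac, hic⟩ := exists_third_axis hai
  obtain ⟨U, W, e⟩ := (h.exists_mul_eq h1.right h1.left h2.left ((form_comm _ _).trans h1.tangent)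
    ((form_comm _ _).trans h2.tangent) hai hac hic hao h1.odd).1 h2.odd
  rw [chiTwo_even_const ha ha' hb (ne_zero_of_isCoprime_odd ha h1.coprime) hp hp' h1.coprime
    h2.coprime (by rw [add_comm, add_comm _ (eval Q D)]; exact e)]

theorem coprimePair_word {l : List OctFace} {p q : OctVertex} (hp : p.1 = i) (hpq : p.1 ≠ q.1)
    (hc : IsCoprime (eval Q (word l (vertex p))) (eval Q (word l (vertex q)))) :
    CoprimePair i Q (word l (vertex p)) (word l (vertex q)) where
  left := reached_word_vertex l p
  right := reached_word_vertex l q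
  tangent := by rw [form_word_word, form_vertex_vertex hpq]
  odd := by rw [odd_word_m, odd_vertex_m, hp]
  coprime := hc

theorem Admissible.odd_eval (h : Admissible T i Q) (l : List OctFace) (s : Bool) :
    Odd (eval Q (word l (vertex (i, s)))) := by
  have h1 := OctType.odd_mod ((h.move l).odd s)
  rw [← eval_vertex, eval_move] at h1
  rw [Int.odd_iff]; omega

/-- An odd circle `C` and a tangent circle `D'` of nonzero even curvature, not necessarily coprime to
it, are linked by a path `C, E, C', D'` of tangent circles whose consecutive curvatures are coprime:
`E` lies on the third axis and is tangent to `C` and `D'`, and `C'` is odd and tangent to `E` and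
`D'`. -/
theorem Admissible.exists_link (h : Admissible T i Q) {j : Fin 3} (hj : j ≠ i)
    (l : List OctFace) (s t : Bool) (hd : eval Q (word l (vertex (j, t))) ≠ 0) :
    ∃ C', CoprimePair i Q C' (word l (vertex (j, t))) ∧
      ∀ D, CoprimePair i Q (word l (vertex (i, s))) D →
        signedChi T Q j (word l (vertex (i, s))) D =
          signedChi T Q j C' (word l (vertex (j, t))) := by
  obtain ⟨k, hjk, hik⟩ := exists_third_axis hj
  have hao := h.odd_eval l s
  obtain ⟨l₁, t₁, hp, hq, hc⟩ := (h.move l).exists_isCoprime (p := (i, s)) (q := (j, t)) (k := k)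
    hj.symm hik hjk (N := eval Q (word l (vertex (i, s)))) (by rintro h0; simp [h0] at hao)
    (Or.inr hao)
  rw [eval_move, ← word_append] at hc
  have hC : word l (vertex (i, s)) = word (l ++ l₁) (vertex (i, s)) := by rw [word_append, hp]
  have hD : word l (vertex (j, t)) = word (l ++ l₁) (vertex (j, t)) := by rw [word_append, hq]
  have pair1 : CoprimePair i Q (word l (vertex (i, s))) (word (l ++ l₁) (vertex (k, t₁))) := by
    rw [hC] at hc ⊢
    exact coprimePair_word rfl hik hc.symm
  have he : eval Q (word (l ++ l₁) (vertex (k, t₁))) ≠ 0 := by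
    obtain ⟨ha, -⟩ := h.residues pair1.left pair1.right pair1.tangent pair1.odd
    exact ne_zero_of_isCoprime_odd ha pair1.coprime
  obtain ⟨l₂, t₂, hp', hq', hc'⟩ := (h.move (l ++ l₁)).exists_isCoprime (p := (j, t))
    (q := (k, t₁)) (k := i) hjk hj hik.symm (mul_ne_zero hd he) (Or.inl rfl)
  rw [eval_move, ← word_append] at hc'
  have hD' : word l (vertex (j, t)) = word (l ++ l₁ ++ l₂) (vertex (j, t)) := by
    rw [hD, word_append (l ++ l₁), hp']
  have hE' : word (l ++ l₁) (vertex (k, t₁)) = word (l ++ l₁ ++ l₂) (vertex (k, t₁)) := by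
    rw [word_append (l ++ l₁), hq']
  have pair2 : CoprimePair i Q (word (l ++ l₁ ++ l₂) (vertex (i, t₂)))
      (word (l ++ l₁) (vertex (k, t₁))) := by
    have := hc'.of_mul_right_right
    rw [hE'] at this ⊢
    exact coprimePair_word rfl hik this
  have pair3 : CoprimePair i Q (word (l ++ l₁ ++ l₂) (vertex (i, t₂)))
      (word l (vertex (j, t))) := by
    have := hc'.of_mul_right_left
    rw [hD'] at this ⊢
    exact coprimePair_word rfl hj.symm this
  refine ⟨_, pair3, fun D hD => ?_⟩
  rw [h.signedChi_eq_of_left hj hD pair1, h.signedChi_eq_of_right j pair1 pair2,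
    h.signedChi_eq_of_left hj pair2 pair3]

/-- The symbols of the two ends of the odd axis agree, as both are linked to an even circle of nonzero
curvature tangent to both. -/
theorem Admissible.signedChi_eq_of_opposite (h : Admissible T i Q) {j : Fin 3} (hj : j ≠ i)
    (l : List OctFace) (s s' : Bool) {D D' : OctVec}
    (h1 : CoprimePair i Q (word l (vertex (i, s))) D)
    (h2 : CoprimePair i Q (word l (vertex (i, s'))) D') :
    signedChi T Q j (word l (vertex (i, s))) D = signedChi T Q j (word l (vertex (i, s'))) D' := by
  obtain ⟨t, ht⟩ : ∃ t, eval Q (word l (vertex (j, t))) ≠ 0 := by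
    by_contra! hc
    have e1 := hc true
    have e2 := hc false
    rw [← eval_move, eval_vertex] at e1 e2
    have := (h.move l).pos
    simp [endSign] at e1 e2
    linarith
  obtain ⟨C₁, hp1, e1⟩ := h.exists_link hj l s t ht
  obtain ⟨C₂, hp2, e2⟩ := h.exists_link hj l s' t ht
  rw [e1 D h1, e2 D' h2]
  exact h.signedChi_eq_of_right j hp1 hp2

theorem Admissible.exists_coprimePair_left (h : Admissible T i Q) (l : List OctFace) (s : Bool) :
    ∃ D, CoprimePair i Q (word l (vertex (i, s))) D := by
  obtain ⟨j, hij⟩ : ∃ j, i ≠ j := exists_other_axis i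
  obtain ⟨k, hik, hjk⟩ := exists_third_axis hij
  have hao := h.odd_eval l s
  obtain ⟨l₁, t₁, hp, -, hc⟩ := (h.move l).exists_isCoprime (p := (i, s)) (q := (j, true)) (k := k)
    hij hik hjk (N := eval Q (word l (vertex (i, s)))) (by rintro h0; simp [h0] at hao)
    (Or.inr hao)
  rw [eval_move, ← word_append] at hc
  have hC : word l (vertex (i, s)) = word (l ++ l₁) (vertex (i, s)) := by rw [word_append, hp]
  refine ⟨word (l ++ l₁) (vertex (k, t₁)), ?_⟩
  rw [hC] at hc ⊢
  exact coprimePair_word rfl hik hc.symm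

/-- Adjacent configurations share one end of the odd axis, so the sign spreads from the base
configuration to the whole packing. -/
theorem Admissible.exists_forall_signedChi_eq (h : Admissible T i Q) {j : Fin 3} (hj : j ≠ i) :
    ∃ ε, ∀ C D, CoprimePair i Q C D → signedChi T Q j C D = ε := by
  obtain ⟨D₀, h0⟩ := h.exists_coprimePair_left [] true
  refine ⟨signedChi T Q j (word [] (vertex (i, true))) D₀, fun C D hCD => ?_⟩
  have key : ∀ (l : List OctFace) (s : Bool) (D : OctVec),
      CoprimePair i Q (word l (vertex (i, s))) D → signedChi T Q j (word l (vertex (i, s))) D =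
        signedChi T Q j (word [] (vertex (i, true))) D₀ := by
    intro l
    induction l using List.reverseRecOn with
    | nil => exact fun s D hD => h.signedChi_eq_of_opposite hj [] s true hD h0
    | append_singleton l φ ih =>
      intro s D hD
      have e : word (l ++ [φ]) (vertex (i, φ i)) = word l (vertex (i, φ i)) := by
        rw [word_concat, refl_vertex (p := (i, φ i)) rfl]
      obtain ⟨D₁, hD₁⟩ := h.exists_coprimePair_left (l ++ [φ]) (φ i)
      rw [h.signedChi_eq_of_opposite hj (l ++ [φ]) s (φ i) hD hD₁]
      rw [e] at hD₁ ⊢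
      exact ih _ _ hD₁
  obtain ⟨l, p, rfl⟩ := hCD.left.exists_word
  have hp := hCD.odd
  rw [odd_word_m, odd_vertex_m] at hp
  subst hp
  exact key l p.2 D hCD

theorem chiTwo_eq_one_or (h : Admissible T i Q) {C D : OctVec} (h1 : CoprimePair i Q C D) :
    chiTwo T (eval Q C) (eval Q D) = 1 ∨ chiTwo T (eval Q C) (eval Q D) = -1 := by
  obtain ⟨ha, -, hp, -⟩ := h.residues h1.left h1.right h1.tangent h1.odd
  rw [chiTwo_odd ha hp]
  apply jacobiSym.eq_one_or_neg_one
  rw [← Int.isCoprime_iff_gcd_eq_one, add_comm]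
  exact (isCoprime_add_iff.2 h1.coprime.symm).of_isCoprime_of_dvd_right (Int.natAbs_dvd.2 dvd_rfl)

/-- The symbol `χ₂` is constant on the pairs of each of the two colours, with opposite values. -/
theorem Admissible.exists_sign (h : Admissible T i Q) {j k : Fin 3} (hj : j ≠ i) (hjk : j ≠ k) :
    ∃ ε : ℤ, (ε = 1 ∨ ε = -1) ∧ ∀ C D, CoprimePair i Q C D →
      (Odd (D.m j) → chiTwo T (eval Q C) (eval Q D) = ε) ∧
      (Odd (D.m k) → chiTwo T (eval Q C) (eval Q D) = -ε) := by
  obtain ⟨ε, hε⟩ := h.exists_forall_signedChi_eq hj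
  refine ⟨ε, ?_, fun C D hCD => ⟨fun ho => ?_, fun ho => ?_⟩⟩
  · obtain ⟨D₀, h0⟩ := h.exists_coprimePair_left [] true
    rw [← hε _ _ h0, signedChi]
    rcases chiTwo_eq_one_or h h0 with e | e <;> rw [e] <;> split_ifs <;> simp
  · rw [← hε _ _ hCD, signedChi, if_pos (Int.odd_iff.1 ho), one_mul]
  · obtain ⟨x, hx⟩ := hCD.right.exists_axis
    have hj' : ¬ Odd (D.m j) := fun hc => hjk (((hx j).1 hc).trans ((hx k).1 ho).symm)
    rw [← hε _ _ hCD, signedChi, if_neg (fun hc => hj' (Int.odd_iff.2 hc))]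
    ring

/-- No circle of even curvature is a line: otherwise two of its odd neighbours would have coprime
positive curvatures whose product is a square, hence be odd squares. -/
theorem Admissible.eval_ne_zero (h : Admissible T i Q) {D : OctVec} (hD : Reached D) {j : Fin 3}
    (hj : j ≠ i) (ho : Odd (D.m j)) : eval Q D ≠ 0 := by
  intro hd
  obtain ⟨l, p, rfl⟩ := hD.exists_word
  have hp := ho
  rw [odd_word_m, odd_vertex_m] at hp
  subst hp
  obtain ⟨k, hjk, hik⟩ := exists_third_axis hj
  have hao := h.odd_eval l true
  obtain ⟨l₁, t₁, hp, -, hc⟩ := (h.move l).exists_isCoprime (p := p) (q := (k, true)) (k := i)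
    hjk hj hik.symm (N := eval Q (word l (vertex (i, true)))) (by rintro h0; simp [h0] at hao)
    (Or.inl rfl)
  rw [eval_move, ← word_append] at hc
  have hD' : word l (vertex p) = word (l ++ l₁) (vertex p) := by rw [word_append, hp]
  have r1 := reached_word_vertex l (i, true)
  have r2 := reached_word_vertex (l ++ l₁) (i, t₁)
  have f1 : form (word l (vertex p)) (word l (vertex (i, true))) = -1 := by
    rw [form_word_word, form_vertex_vertex hj]
  have f2 : form (word l (vertex p)) (word (l ++ l₁) (vertex (i, t₁))) = -1 := by
    rw [hD', form_word_word, form_vertex_vertex hj]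
  have o1 : Odd ((word l (vertex (i, true))).m i) := by rw [odd_word_m, odd_vertex_m]
  have o2 : Odd ((word (l ++ l₁) (vertex (i, t₁))).m i) := by rw [odd_word_m, odd_vertex_m]
  obtain ⟨U, W, e⟩ := (h.exists_mul_eq hD r1 r2 f1 f2 hj hjk hik ho o1).1 o2
  obtain ⟨ha, -, hpos, -⟩ := h.residues r1 hD ((form_comm _ _).trans f1) o1
  rw [hd] at e hpos
  simp only [zero_add, add_zero, zero_mul] at e hpos
  have hm := OctType.odd_mod ha
  obtain ⟨b, hb⟩ := Int.sq_of_isCoprime hc.symm e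
  rcases hb with hb | hb
  · rw [hb] at hm
    have h8 : b ^ 2 % 8 = (b % 8) ^ 2 % 8 := by
      simp only [sq, Int.mul_emod, Int.emod_emod_of_dvd, dvd_refl]
    rw [h8] at hm
    have h1 := Int.emod_nonneg b (show (8:ℤ) ≠ 0 by norm_num)
    have h2 := Int.emod_lt_of_pos b (show (0:ℤ) < 8 by norm_num)
    interval_cases b % 8 <;> simp at hm
  · nlinarith [sq_nonneg b]

theorem Admissible.exists_coprimePair_right (h : Admissible T i Q) {D : OctVec} (hD : Reached D)
    {j : Fin 3} (hj : j ≠ i) (ho : Odd (D.m j)) : ∃ C, CoprimePair i Q C D := by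
  have hd := h.eval_ne_zero hD hj ho
  obtain ⟨l, p, rfl⟩ := hD.exists_word
  rw [odd_word_m, odd_vertex_m] at ho
  subst ho
  obtain ⟨k, hjk, hik⟩ := exists_third_axis hj
  obtain ⟨l₁, t₁, hp, -, hc⟩ := (h.move l).exists_isCoprime (p := p) (q := (k, true)) (k := i)
    hjk hj hik.symm hd (Or.inl rfl)
  rw [eval_move, ← word_append] at hc
  have hD' : word l (vertex p) = word (l ++ l₁) (vertex p) := by rw [word_append, hp]
  refine ⟨word (l ++ l₁) (vertex (i, t₁)), ?_⟩
  rw [hD'] at hc ⊢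
  exact coprimePair_word rfl hj.symm hc

theorem Admissible.exists_chiTwo_of_sq (h : Admissible T i Q) {D : OctVec} (hD : Reached D)
    {j : Fin 3} (hj : j ≠ i) (ho : Odd (D.m j)) :
    ∃ C, CoprimePair i Q C D ∧ (∀ n, eval Q D = n ^ 2 → chiTwo T (eval Q C) (eval Q D) = 1) ∧
      ∀ n, eval Q D = 2 * n ^ 2 → chiTwo T (eval Q C) (eval Q D) = -1 := by
  obtain ⟨C, hCD⟩ := h.exists_coprimePair_right hD hj ho
  obtain ⟨ha, hb, -⟩ := h.residues hCD.left hCD.right hCD.tangent hCD.odd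
  exact ⟨C, hCD, fun n hn => (h.chiTwo_comm hCD).trans (chiTwo_even_sq ha hb hCD.coprime hn),
    fun n hn => (h.chiTwo_comm hCD).trans (chiTwo_even_two_mul_sq ha hb hCD.coprime hn)⟩

end CurvData

/-! ### Geometry of the configuration -/

/-- The Lorentzian form on `ℝ⁴` in the inversive coordinates `(cocurv, curv, hx, hy)`. -/
noncomputable def lorentz : LinearMap.BilinForm ℝ (Fin 4 → ℝ) :=
  LinearMap.mk₂ ℝ (fun x y => x 2 * y 2 + x 3 * y 3 - (x 1 * y 0 + x 0 * y 1) / 2)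
    (fun x y z => by simp only [Pi.add_apply]; ring)
    (fun c x y => by simp only [Pi.smul_apply, smul_eq_mul]; ring)
    (fun x y z => by simp only [Pi.add_apply]; ring)
    (fun c x y => by simp only [Pi.smul_apply, smul_eq_mul]; ring)

theorem lorentz_apply (x y : Fin 4 → ℝ) :
    lorentz x y = x 2 * y 2 + x 3 * y 3 - (x 1 * y 0 + x 0 * y 1) / 2 := rfl

theorem lorentz_comm (x y : Fin 4 → ℝ) : lorentz x y = lorentz y x := by
  simp only [lorentz_apply]; ring

theorem eq_zero_of_forall_lorentz {u : Fin 4 → ℝ} (h : ∀ x, lorentz x u = 0) : u = 0 := by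
  ext a
  have h0 := h (Pi.single 0 1)
  have h1 := h (Pi.single 1 1)
  have h2 := h (Pi.single 2 1)
  have h3 := h (Pi.single 3 1)
  simp [lorentz_apply] at h0 h1 h2 h3
  fin_cases a <;> simp <;> linarith

/-- Three pairwise tangent circles and their common orthogonal circle have a nondegenerate
Gram matrix, so a vector orthogonal to all four vanishes. -/
theorem eq_zero_of_lorentz_face {v : Fin 3 → Fin 4 → ℝ} {d : Fin 4 → ℝ}
    (hv : ∀ i, lorentz (v i) (v i) = 1) (hvv : ∀ i j, i ≠ j → lorentz (v i) (v j) = -1)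
    (hd : lorentz d d = 1) (hvd : ∀ i, lorentz (v i) d = 0) {u : Fin 4 → ℝ}
    (hu : ∀ i, lorentz (v i) u = 0) (hud : lorentz d u = 0) : u = 0 := by
  have hli : LinearIndependent ℝ ![d, v 0, v 1, v 2] := by
    rw [Fintype.linearIndependent_iff]
    intro g hg
    simp [Fin.sum_univ_four] at hg
    have hdv : ∀ i, lorentz d (v i) = 0 := fun i => by rw [lorentz_comm, hvd]
    have e : ∀ x, g 0 * lorentz x d + g 1 * lorentz x (v 0) + g 2 * lorentz x (v 1) +
        g 3 * lorentz x (v 2) = 0 := by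
      intro x
      have := congrArg (lorentz x) hg
      simpa using this
    have ed := e d
    have e0 := e (v 0)
    have e1 := e (v 1)
    have e2 := e (v 2)
    rw [hd, hdv, hdv, hdv] at ed
    rw [hvd, hv, hvv 0 1 (by decide), hvv 0 2 (by decide)] at e0
    rw [hvd, hv, hvv 1 0 (by decide), hvv 1 2 (by decide)] at e1
    rw [hvd, hv, hvv 2 0 (by decide), hvv 2 1 (by decide)] at e2
    intro a
    fin_cases a <;> simp <;> linarith
  have hspan := hli.span_eq_top_of_card_eq_finrank' (by simp)
  apply eq_zero_of_forall_lorentz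
  intro x
  have hx : x ∈ Submodule.span ℝ (Set.range ![d, v 0, v 1, v 2]) := by rw [hspan]; trivial
  induction hx using Submodule.span_induction with
  | mem y hy =>
    obtain ⟨a, rfl⟩ := hy
    fin_cases a
    exacts [hud, hu 0, hu 1, hu 2]
  | zero => simp
  | add y z _ _ h1 h2 => simp [h1, h2]
  | smul c y _ h1 => simp [h1]

namespace OrientedCircle

/-- The inversive coordinates as a vector. -/
def coords (C : OrientedCircle) : Fin 4 → ℝ := ![C.cocurv, C.curv, C.hx, C.hy]

theorem coords_injective : Function.Injective coords := by
  intro C D h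
  have h0 := congrFun h 0
  have h1 := congrFun h 1
  have h2 := congrFun h 2
  have h3 := congrFun h 3
  exact OrientedCircle.ext h0 h1 h2 h3

theorem pairing_eq (C D : OrientedCircle) : C.pairing D = lorentz C.coords D.coords := rfl

theorem lorentz_self (C : OrientedCircle) : lorentz C.coords C.coords = 1 := by
  rw [← C.norm_eq, lorentz_apply]
  simp only [coords, Matrix.cons_val]
  ring

theorem coords_reflect (D C : OrientedCircle) :
    (reflect D C).coords = C.coords - (2 * C.pairing D) • D.coords := by
  ext a; fin_cases a <;> simp [coords, reflect]

end OrientedCircle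

namespace OctahedralConfiguration

open OrientedCircle OctVec

variable (P : OctahedralConfiguration)

/-- Rigidity of the configuration: the two ends of every axis have the same sum, which is determined
by the dual circle of any face. -/
theorem coords_add_coords_not (φ : OctFace) (i : Fin 3) :
    (P.base (i, φ i)).coords + (P.base (i, !φ i)).coords =
      (2 : ℝ) • ∑ j, (P.base (j, φ j)).coords - √8 • (P.dual φ).coords := by
  set v : Fin 3 → Fin 4 → ℝ := fun j => (P.base (j, φ j)).coords with hv_def
  set v' : Fin 3 → Fin 4 → ℝ := fun j => (P.base (j, !φ j)).coords with hv'_def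
  set d := (P.dual φ).coords with hd_def
  have hv : ∀ j, lorentz (v j) (v j) = 1 := fun j => lorentz_self _
  have hv' : ∀ j, lorentz (v' j) (v' j) = 1 := fun j => lorentz_self _
  have hd : lorentz d d = 1 := lorentz_self _
  have hvv : ∀ j k, j ≠ k → lorentz (v j) (v k) = -1 :=
    fun j k hjk => P.base_tangent (j, φ j) (k, φ k) hjk
  have hvv' : ∀ j k, j ≠ k → lorentz (v j) (v' k) = -1 :=
    fun j k hjk => P.base_tangent (j, φ j) (k, !φ k) hjk
  have hvv'' : ∀ j k, j ≠ k → lorentz (v' j) (v' k) = -1 :=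
    fun j k hjk => P.base_tangent (j, !φ j) (k, !φ k) hjk
  have hvd : ∀ j, lorentz (v j) d = 0 :=
    fun j => P.base_dual_orthogonal (j, φ j) φ rfl
  have hy : ∀ j, lorentz (v' j) d < -1 :=
    fun j => P.base_dual_separated (j, !φ j) φ (by simp)
  -- The opposite circle in terms of the face, with two unknown pairings.
  have expand : ∀ i j k, i ≠ j → i ≠ k → j ≠ k → v' i = v i +
      ((1 - lorentz (v i) (v' i)) / 2) • (v j + v k) + lorentz (v' i) d • d := by
    intro i j k hij hik hjk
    rw [← sub_eq_zero]
    apply eq_zero_of_lorentz_face hv hvv hd hvd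
    · intro l
      rcases axis_cases hij hik hjk l with rfl | rfl | rfl
      · simp only [map_sub, map_add, map_smul, smul_eq_mul, hv, hvd, hvv _ _ hij, hvv _ _ hik]
        ring
      · simp only [map_sub, map_add, map_smul, smul_eq_mul, hv, hvd, hvv _ _ hjk,
          hvv _ _ hij.symm, hvv' _ _ hij.symm]
        ring
      · simp only [map_sub, map_add, map_smul, smul_eq_mul, hv, hvd, hvv _ _ hjk.symm,
          hvv _ _ hik.symm, hvv' _ _ hik.symm]
        ring
    · simp only [map_sub, map_add, map_smul, smul_eq_mul, hd, lorentz_comm d (v _), hvd,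
        lorentz_comm d (v' _)]
      ring
  have norm : ∀ i, lorentz (v' i) d ^ 2 = 2 - 2 * lorentz (v i) (v' i) := by
    intro i
    obtain ⟨j, hij⟩ : ∃ j, i ≠ j := exists_other_axis i
    obtain ⟨k, hik, hjk⟩ := exists_third_axis hij
    have h := congrArg (lorentz (v' i)) (expand i j k hij hik hjk)
    simp only [map_add, map_smul, smul_eq_mul, lorentz_comm (v' i) (v _), hv', hvv' _ _ hij.symm,
      hvv' _ _ hik.symm] at h
    linarith
  have prod : ∀ i j, i ≠ j → lorentz (v' i) d * lorentz (v' j) d = 8 := by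
    intro i j hij
    obtain ⟨k, hik, hjk⟩ := exists_third_axis hij
    have h := congrArg (lorentz (v' i)) (expand j i k hij.symm hjk hik)
    simp only [map_add, map_smul, smul_eq_mul, lorentz_comm (v' i) (v _), hvv'' _ _ hij,
      hvv' _ _ hij.symm, hvv' _ _ hik.symm] at h
    have hi := norm i
    have hj := norm j
    have yi := hy i
    have yj := hy j
    generalize lorentz (v' i) d = y at *
    generalize lorentz (v' j) d = z at *
    have hyz : y * z ≠ 0 := by nlinarith
    apply mul_left_cancel₀ hyz
    have e1 : lorentz (v i) (v' i) = 1 - y ^ 2 / 2 := by linarith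
    have e2 : lorentz (v j) (v' j) = 1 - z ^ 2 / 2 := by linarith
    rw [e1, e2] at h
    linear_combination 8 * h
  obtain ⟨j, hij⟩ : ∃ j, i ≠ j := exists_other_axis i
  obtain ⟨k, hik, hjk⟩ := exists_third_axis hij
  -- All three products of two of the pairings are `8`, so each pairing is `-√8`.
  have hsq : lorentz (v' i) d ^ 2 = 8 := by
    have h1 := prod i j hij
    have h2 := prod i k hik
    have h3 := prod j k hjk
    have yi := hy i
    have e : lorentz (v' i) d ^ 2 * 8 = 8 * 8 := by
      linear_combination (-lorentz (v' i) d ^ 2) * h3 +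
        (lorentz (v' i) d * lorentz (v' k) d) * h1 + 8 * h2
    linarith
  have hroot : lorentz (v' i) d = -√8 := by
    have h8 : √8 = -lorentz (v' i) d := by
      rw [Real.sqrt_eq_iff_mul_self_eq (by norm_num) (by linarith [hy i])]
      linarith
    linarith
  have hx : lorentz (v i) (v' i) = -3 := by linarith [norm i]
  have h := expand i j k hij hik hjk
  rw [hroot, hx] at h
  change v i + v' i = (2 : ℝ) • ∑ j, v j - √8 • d
  rw [sum_axes _ hij hik hjk, h]
  module

/-- The common half-sum of the two ends of each axis. -/
noncomputable def center : Fin 4 → ℝ :=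
  (1 / 2 : ℝ) • ((P.base (0, true)).coords + (P.base (0, false)).coords)

/-- The displacement of the positive end of an axis from the centre. -/
noncomputable def axis (i : Fin 3) : Fin 4 → ℝ := (P.base (i, true)).coords - P.center

theorem coords_add_coords (i : Fin 3) :
    (P.base (i, true)).coords + (P.base (i, false)).coords = (2 : ℝ) • P.center := by
  have h1 := P.coords_add_coords_not (fun _ => true) i
  have h2 := P.coords_add_coords_not (fun _ => true) 0
  simp only [Bool.not_true] at h1 h2
  rw [h1, center, h2]
  module

theorem coords_base (i : Fin 3) (s : Bool) :
    (P.base (i, s)).coords = P.center + (endSign s : ℝ) • P.axis i := by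
  cases s
  · have := P.coords_add_coords i
    simp only [axis, endSign, Bool.false_eq_true, if_false, Int.cast_neg, Int.cast_one]
    rw [eq_sub_of_add_eq' this]; module
  · simp [axis, endSign]

theorem coords_dual (φ : OctFace) :
    √8 • (P.dual φ).coords =
      (4 : ℝ) • P.center + (2 : ℝ) • ∑ i, (endSign (φ i) : ℝ) • P.axis i := by
  have h := P.coords_add_coords_not φ 0
  have e : (P.base (0, φ 0)).coords + (P.base (0, !φ 0)).coords = (2 : ℝ) • P.center := by
    rw [coords_base, coords_base, endSign_not]; push_cast; module
  rw [e] at h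
  simp only [coords_base, Fin.sum_univ_three] at h ⊢
  rw [eq_sub_iff_add_eq] at h
  rw [← sub_eq_iff_eq_add'.2 h.symm]
  module

theorem lorentz_base_opposite (i : Fin 3) :
    lorentz (P.base (i, true)).coords (P.base (i, false)).coords = -3 := by
  obtain ⟨j, hij⟩ : ∃ j, i ≠ j := exists_other_axis i
  obtain ⟨k, hik, hjk⟩ := exists_third_axis hij
  have h := congrArg (lorentz (P.base (i, true)).coords)
    (P.coords_add_coords_not (fun _ => true) i)
  have h1 : lorentz (P.base (i, true)).coords (P.base (j, true)).coords = -1 :=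
    P.base_tangent (i, true) (j, true) hij
  have h2 : lorentz (P.base (i, true)).coords (P.base (k, true)).coords = -1 :=
    P.base_tangent (i, true) (k, true) hik
  have h3 : lorentz (P.base (i, true)).coords (P.dual fun _ => true).coords = 0 :=
    P.base_dual_orthogonal (i, true) (fun _ => true) rfl
  simp only [sum_axes _ hij hik hjk, map_sub, map_add, map_smul, smul_eq_mul, lorentz_self, h1, h2,
    h3, Bool.not_true] at h
  linarith

theorem axis_eq (i : Fin 3) : P.axis i =
    (1 / 2 : ℝ) • ((P.base (i, true)).coords - (P.base (i, false)).coords) := by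
  rw [coords_base, coords_base]
  simp only [endSign, Bool.false_eq_true, if_false, if_true, Int.cast_neg, Int.cast_one]
  module

theorem center_eq (i : Fin 3) : P.center =
    (1 / 2 : ℝ) • ((P.base (i, true)).coords + (P.base (i, false)).coords) := by
  rw [coords_add_coords]; module

theorem lorentz_center_center : lorentz P.center P.center = -1 := by
  have h := P.lorentz_base_opposite 0
  have h' := lorentz_comm (P.base (0, true)).coords (P.base (0, false)).coords
  simp only [center, map_add, map_smul, LinearMap.add_apply, LinearMap.smul_apply, smul_eq_mul,
    lorentz_self]
  linarith

theorem lorentz_axis_self (i : Fin 3) : lorentz (P.axis i) (P.axis i) = 2 := by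
  have h := P.lorentz_base_opposite i
  have h' := lorentz_comm (P.base (i, true)).coords (P.base (i, false)).coords
  simp only [axis_eq, map_sub, map_smul, LinearMap.sub_apply, LinearMap.smul_apply, smul_eq_mul,
    lorentz_self]
  linarith

theorem lorentz_center_axis (i : Fin 3) : lorentz P.center (P.axis i) = 0 := by
  have h' := lorentz_comm (P.base (i, true)).coords (P.base (i, false)).coords
  rw [axis_eq, P.center_eq i]
  simp only [map_add, map_sub, map_smul, LinearMap.add_apply, LinearMap.smul_apply, smul_eq_mul,
    lorentz_self]
  linarith

theorem lorentz_axis_axis {i j : Fin 3} (hij : i ≠ j) : lorentz (P.axis i) (P.axis j) = 0 := by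
  have h : ∀ s t, lorentz (P.base (i, s)).coords (P.base (j, t)).coords = -1 :=
    fun s t => P.base_tangent (i, s) (j, t) hij
  simp only [axis_eq, map_sub, map_smul, LinearMap.sub_apply, LinearMap.smul_apply, smul_eq_mul, h]
  ring

/-- The vector of `ℝ⁴` with given lattice coordinates. -/
noncomputable def realize (v : OctVec) : Fin 4 → ℝ :=
  (v.n : ℝ) • P.center + ∑ i, (v.m i : ℝ) • P.axis i

theorem lorentz_realize_center (v : OctVec) : lorentz (P.realize v) P.center = -v.n := by
  simp [realize, Fin.sum_univ_three, lorentz_center_center, lorentz_comm (P.axis _) P.center,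
    lorentz_center_axis]

theorem lorentz_realize_axis (v : OctVec) (i : Fin 3) :
    lorentz (P.realize v) (P.axis i) = 2 * v.m i := by
  obtain ⟨j, hij⟩ : ∃ j, i ≠ j := exists_other_axis i
  obtain ⟨k, hik, hjk⟩ := exists_third_axis hij
  simp [realize, sum_axes _ hij hik hjk, lorentz_center_axis, lorentz_axis_self,
    lorentz_axis_axis P hij.symm, lorentz_axis_axis P hik.symm, mul_comm]

theorem lorentz_realize (v w : OctVec) :
    lorentz (P.realize v) (P.realize w) = (form v w : ℤ) := by
  conv_lhs => rw [realize.eq_def P w]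
  simp only [Fin.sum_univ_three, map_add, map_smul, smul_eq_mul, lorentz_realize_center,
    lorentz_realize_axis, form]
  push_cast
  ring

theorem realize_vertex (p : OctVertex) : P.realize (vertex p) = (P.base p).coords := by
  rcases p with ⟨i, s⟩
  rw [coords_base, realize]
  simp [vertex, ite_smul]

theorem lorentz_realize_dual (φ : OctFace) (v : OctVec) :
    √8 * lorentz (P.realize v) (P.dual φ).coords = 4 * height φ v := by
  have h := congrArg (lorentz (P.realize v)) (P.coords_dual φ)
  simp only [map_add, map_smul, smul_eq_mul, Fin.sum_univ_three, lorentz_realize_center,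
    lorentz_realize_axis] at h
  rw [h, height, Fin.sum_univ_three]
  push_cast
  ring

theorem realize_refl (φ : OctFace) (v : OctVec) : P.realize (OctVec.refl φ v) =
    P.realize v - (2 * lorentz (P.realize v) (P.dual φ).coords) • (P.dual φ).coords := by
  have h := P.lorentz_realize_dual φ v
  have h8 : √8 * √8 = 8 := Real.mul_self_sqrt (by norm_num)
  have e : 2 * lorentz (P.realize v) (P.dual φ).coords = (height φ v : ℝ) * √8 := by
    linear_combination (√8 / 4) * h - (lorentz (P.realize v) (P.dual φ).coords / 4) * h8
  rw [e, mul_smul, coords_dual]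
  simp only [realize, OctVec.refl, Fin.sum_univ_three]
  push_cast
  module

/-- The circle obtained from a base circle by the reflections of a list of faces. -/
noncomputable def circle (l : List OctFace) (p : OctVertex) : OrientedCircle :=
  l.foldr (fun φ C => reflect (P.dual φ) C) (P.base p)

theorem coords_circle (l : List OctFace) (p : OctVertex) :
    (P.circle l p).coords = P.realize (word l (vertex p)) := by
  induction l with
  | nil => exact (P.realize_vertex p).symm
  | cons φ l ih =>
    change (reflect (P.dual φ) (P.circle l p)).coords = P.realize (OctVec.refl φ (word l (vertex p)))
    rw [coords_reflect, pairing_eq, ih, realize_refl]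

theorem circle_eq_of_word_eq {l l' : List OctFace} {p q : OctVertex}
    (h : word l (vertex p) = word l' (vertex q)) : P.circle l p = P.circle l' q := by
  apply coords_injective; rw [coords_circle, coords_circle, h]

theorem pairing_circle (l l' : List OctFace) (p q : OctVertex) :
    (P.circle l p).pairing (P.circle l' q) = (form (word l (vertex p)) (word l' (vertex q)) : ℤ) := by
  rw [pairing_eq, coords_circle, coords_circle, lorentz_realize]

theorem tangent_circle_iff {l l' : List OctFace} {p q : OctVertex} :
    (P.circle l p).Tangent (P.circle l' q) ↔ form (word l (vertex p)) (word l' (vertex q)) = -1 := by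
  rw [Tangent, pairing_circle]; norm_cast

theorem circle_mem_packing (l : List OctFace) (p : OctVertex) : P.circle l p ∈ P.packing := by
  have h : ∃ g ∈ P.apollonianGroup, P.circle l p = g (P.base p) := by
    induction l with
    | nil => exact ⟨1, one_mem _, rfl⟩
    | cons φ l ih =>
      obtain ⟨g, hg, e⟩ := ih
      refine ⟨(P.dual φ).reflection * g, mul_mem (Subgroup.subset_closure ⟨φ, rfl⟩) hg, ?_⟩
      change reflect (P.dual φ) (P.circle l p) = _
      rw [e]; rfl
  obtain ⟨g, hg, e⟩ := h
  exact ⟨g, hg, p, e⟩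

theorem exists_eq_circle {C : OrientedCircle} (hC : C ∈ P.packing) : ∃ l p, C = P.circle l p := by
  obtain ⟨g, hg, p, rfl⟩ := hC
  have key : ∀ l, (∃ l', g (P.circle l p) = P.circle l' p) ∧
      ∃ l', g⁻¹ (P.circle l p) = P.circle l' p := by
    induction hg using Subgroup.closure_induction with
    | mem g hg =>
      obtain ⟨φ, rfl⟩ := hg
      exact fun l => ⟨⟨φ :: l, rfl⟩, ⟨φ :: l, rfl⟩⟩
    | one => exact fun l => ⟨⟨l, rfl⟩, ⟨l, by simp⟩⟩
    | mul g g' _ _ ih ih' =>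
      intro l
      constructor
      · obtain ⟨l₁, h1⟩ := (ih' l).1
        obtain ⟨l₂, h2⟩ := (ih l₁).1
        exact ⟨l₂, by rw [Equiv.Perm.mul_apply, h1, h2]⟩
      · obtain ⟨l₁, h1⟩ := (ih l).2
        obtain ⟨l₂, h2⟩ := (ih' l₁).2
        exact ⟨l₂, by rw [mul_inv_rev, Equiv.Perm.mul_apply, h1, h2]⟩
    | inv g _ ih => exact fun l => ⟨(ih l).2, by rw [inv_inv]; exact (ih l).1⟩
  obtain ⟨l, hl⟩ := (key []).1
  exact ⟨l, p, hl⟩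

/-- The curvature functional is null, being the pairing with the point at infinity. -/
theorem sum_axis_curv_sq : ∑ i, P.axis i 1 ^ 2 = 2 * P.center 1 ^ 2 := by
  let K : Fin 4 → ℝ := ![-2, 0, 0, 0]
  have hK : ∀ x, lorentz x K = x 1 := by intro x; simp [lorentz_apply, K]; ring
  have hz : K + P.center 1 • P.center - ∑ i, (P.axis i 1 / 2) • P.axis i = 0 := by
    let u := K + P.center 1 • P.center - ∑ i, (P.axis i 1 / 2) • P.axis i
    have hc : lorentz P.center u = 0 := by
      simp [u, Fin.sum_univ_three, hK, lorentz_center_center, lorentz_center_axis]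
    have ha : ∀ i, lorentz (P.axis i) u = 0 := by
      intro i
      obtain ⟨j, hij⟩ : ∃ j, i ≠ j := exists_other_axis i
      obtain ⟨k, hik, hjk⟩ := exists_third_axis hij
      simp [u, sum_axes _ hij hik hjk, hK, lorentz_comm (P.axis _) P.center, lorentz_center_axis,
        lorentz_axis_self, lorentz_axis_axis P hij, lorentz_axis_axis P hik]
    apply eq_zero_of_lorentz_face (v := fun i => (P.base (i, true)).coords)
      (d := (P.dual fun _ => true).coords)
    · exact fun i => lorentz_self _
    · exact fun i j hij => P.base_tangent (i, true) (j, true) hij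
    · exact lorentz_self _
    · exact fun i => P.base_dual_orthogonal (i, true) (fun _ => true) rfl
    · intro i
      change lorentz _ u = 0
      rw [coords_base]
      simp [hc, ha]
    · change lorentz _ u = 0
      have h := congrArg (fun x => lorentz x u) (P.coords_dual fun _ => true)
      simp only [map_add, map_smul, LinearMap.add_apply, LinearMap.smul_apply, smul_eq_mul, hc,
        Fin.sum_univ_three, ha] at h
      have h8 : √8 ≠ 0 := by positivity
      have h' : √8 * lorentz (P.dual fun _ => true).coords u = 0 := by rw [h]; ring
      exact (mul_eq_zero.1 h').resolve_left h8
  have h := congrFun hz 1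
  simp only [Pi.add_apply, Pi.sub_apply, Pi.smul_apply, smul_eq_mul, Pi.zero_apply,
    Fin.sum_univ_three, show K 1 = 0 from rfl] at h
  rw [Fin.sum_univ_three]
  linarith

theorem curv_base (i : Fin 3) (s : Bool) :
    (P.base (i, s)).curv = P.center 1 + endSign s * P.axis i 1 := by
  have h := congrFun (P.coords_base i s) 1
  simpa [coords] using h

end OctahedralConfiguration

/-! ### Translation to circles -/

theorem OctColor.eq_of_ne_yellow {a b c : OctColor} (ha : a ≠ .yellow) (hb : b ≠ .yellow)
    (hc : c ≠ .yellow) (hac : a ≠ c) (hbc : b ≠ c) : a = b := by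
  cases a <;> cases b <;> cases c <;> simp at *

namespace OctahedralConfiguration

open OrientedCircle OctVec CurvData

variable {P : OctahedralConfiguration}

theorem curv_circle {Q : CurvData} (hs : P.center 1 = Q.s) (hx : ∀ i, P.axis i 1 = Q.x i)
    (l : List OctFace) (p : OctVertex) :
    (P.circle l p).curv = (eval Q (word l (vertex p)) : ℤ) := by
  have h := congrFun (P.coords_circle l p) 1
  change (P.circle l p).curv = _ at h
  rw [h, realize, eval]
  simp only [Pi.add_apply, Pi.smul_apply, smul_eq_mul, Fin.sum_univ_three, hs, hx]
  push_cast
  ring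

/-- The curvatures of a primitive integral configuration of type `T` are given by an admissible
integral functional. -/
theorem exists_admissible {T : OctType} (hint : P.IsIntegral) (hprim : P.IsPrimitive)
    (htype : P.HasType T) : ∃ (i : Fin 3) (Q : CurvData), Admissible T i Q ∧
      P.center 1 = Q.s ∧ ∀ j, P.axis j 1 = Q.x j := by
  obtain ⟨i, hodd, heven⟩ := htype
  obtain ⟨n₁, h1, h1'⟩ := hodd true
  obtain ⟨n₂, h2, h2'⟩ := hodd false
  have hpar : ∃ s : ℤ, n₁ + n₂ = 2 * s := by
    have e1 := OctType.odd_mod h1'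
    have e2 := OctType.odd_mod h2'
    exact ⟨(n₁ + n₂) / 2, by omega⟩
  obtain ⟨s, hs'⟩ := hpar
  have hs : P.center 1 = s := by
    rw [curv_base] at h1 h2
    have : (n₁ : ℝ) + n₂ = 2 * s := by exact_mod_cast hs'
    simp [endSign] at h1 h2
    linarith
  choose a ha using fun j => hint _ (P.circle_mem_packing [] (j, true))
  have hx : ∀ j, P.axis j 1 = ((a j - s : ℤ) : ℝ) := by
    intro j
    have := ha j
    change (P.base (j, true)).curv = _ at this
    rw [curv_base, hs] at this
    simp [endSign] at this
    push_cast
    linarith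
  obtain ⟨Q, hQ⟩ : ∃ Q : CurvData, Q = ⟨s, fun j => a j - s⟩ := ⟨_, rfl⟩
  have hQs : P.center 1 = Q.s := by rw [hQ]; exact hs
  have hQx : ∀ j, P.axis j 1 = Q.x j := by rw [hQ]; exact hx
  refine ⟨i, Q, ?_, hQs, hQx⟩
  have hres : ∀ j t r, (P.base (j, t)).CurvModEight r → Q.s + endSign t * Q.x j ≡ r [ZMOD 8] := by
    rintro j t r ⟨n, hn, hr⟩
    rw [curv_base, hQs, hQx] at hn
    have : Q.s + endSign t * Q.x j = n := by exact_mod_cast hn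
    rwa [this]
  have hnull : ∑ j, Q.x j ^ 2 = 2 * Q.s ^ 2 := by
    have := P.sum_axis_curv_sq
    simp only [hQs, hQx] at this
    exact_mod_cast this
  have hresodd := fun t => hres i t _ (hodd t)
  refine ⟨?_, hnull, hresodd, fun j hj => ?_, fun p hp _ hps hpx => ?_⟩
  · -- If the half-sum were negative, each axis would have an end of negative curvature.
    by_contra! hneg
    rcases hneg.eq_or_lt with h0 | hlt
    · have hz : ∀ j, Q.x j = 0 := by
        rw [h0] at hnull
        intro j
        have := (Finset.sum_eq_zero_iff_of_nonneg (fun j _ => sq_nonneg (Q.x j))).1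
          (hnull.trans (by norm_num)) j (Finset.mem_univ j)
        exact pow_eq_zero_iff two_ne_zero |>.1 this
      have := OctType.odd_mod (hresodd true)
      rw [h0, hz i] at this
      simp at this
    · have hend : ∀ j, ∃ t, (P.base (j, t)).curv < 0 := by
        intro j
        by_contra! hc
        have e1 := hc true
        have e2 := hc false
        rw [curv_base] at e1 e2
        have : (Q.s : ℝ) < 0 := by exact_mod_cast hlt
        rw [← hQs] at this
        simp [endSign] at e1 e2
        linarith
      obtain ⟨t, ht⟩ := hend 0
      obtain ⟨t', ht'⟩ := hend 1
      have := P.base_orientation _ _ ht ht'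
      simp at this
  · obtain ⟨t, e1, e2⟩ := heven j hj
    exact ⟨t, hres j t _ e1, hres j (!t) _ e2⟩
  · refine hp.one_lt.ne' (hprim p fun C hC => ?_)
    obtain ⟨l, q, rfl⟩ := P.exists_eq_circle hC
    have hd : (p : ℤ) ∣ eval Q (word l (vertex q)) :=
      (hps.mul_right _).add (Finset.dvd_sum fun j _ => (hpx j).mul_right _)
    obtain ⟨n, hn⟩ := hd
    exact ⟨n, by rw [curv_circle hQs hQx, hn]; push_cast; rfl⟩

theorem circle_concat {l : List OctFace} {φ : OctFace} {p : OctVertex} (h : φ p.1 = p.2) :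
    P.circle (l ++ [φ]) p = P.circle l p :=
  P.circle_eq_of_word_eq (by rw [word_concat, refl_vertex h])

theorem circle_tangent (l : List OctFace) {p q : OctVertex} (h : p.1 ≠ q.1) :
    (P.circle l p).Tangent (P.circle l q) := by
  rw [tangent_circle_iff, form_word_word, form_vertex_vertex h]

/-- The colour of a circle is determined by its axis. -/
theorem IsColoring.exists_axis_color {T : OctType} {i : Fin 3} {Q : CurvData}
    (hQ : Admissible T i Q) (hs : P.center 1 = Q.s) (hx : ∀ i, P.axis i 1 = Q.x i)
    {κ : OrientedCircle → OctColor} (hκ : P.IsColoring κ) :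
    ∃ j k, i ≠ j ∧ i ≠ k ∧ j ≠ k ∧ ∀ l p, (κ (P.circle l p) = .yellow ↔ p.1 = i) ∧
      (κ (P.circle l p) = .red ↔ p.1 = j) ∧ (κ (P.circle l p) = .blue ↔ p.1 = k) := by
  have hyel : ∀ l p, κ (P.circle l p) = .yellow ↔ p.1 = i := by
    rintro l ⟨j, t⟩
    rw [hκ.odd_yellow _ (P.circle_mem_packing l _) _ (curv_circle hs hx l _)]
    constructor
    · intro ho
      by_contra hj
      rw [← eval_move, eval_vertex] at ho
      exact Int.not_odd_iff_even.2 (even_of_isEvenResidue ((hQ.move l).isEvenResidue hj t)) ho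
    · rintro rfl
      exact hQ.odd_eval l t
  have hne : ∀ l (p q : OctVertex), p.1 ≠ q.1 → κ (P.circle l p) ≠ κ (P.circle l q) :=
    fun l p q hpq => hκ.proper _ (P.circle_mem_packing l p) _ (P.circle_mem_packing l q)
      (circle_tangent l hpq)
  have hends : ∀ l j s t, κ (P.circle l (j, s)) = κ (P.circle l (j, t)) := by
    intro l j s t
    by_cases hj : j = i
    · rw [(hyel l (j, s)).2 hj, (hyel l (j, t)).2 hj]
    · obtain ⟨k, hjk, hik⟩ := exists_third_axis hj
      exact OctColor.eq_of_ne_yellow (fun h => hj ((hyel l _).1 h)) (fun h => hj ((hyel l _).1 h))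
        (fun h => hik ((hyel l (k, true)).1 h).symm) (hne l (j, s) (k, true) hjk)
        (hne l (j, t) (k, true) hjk)
  have hconst : ∀ l p, κ (P.circle l p) = κ (P.circle [] (p.1, true)) := by
    intro l
    induction l using List.reverseRecOn with
    | nil => exact fun p => hends [] p.1 p.2 true
    | append_singleton l φ ih =>
      rintro ⟨j, t⟩
      rw [hends _ j t (φ j), circle_concat rfl]
      exact ih _
  obtain ⟨j, hij⟩ : ∃ j, i ≠ j := exists_other_axis i
  obtain ⟨k, hik, hjk⟩ := exists_third_axis hij
  have hi := (hyel [] (i, true)).2 rfl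
  have hj : κ (P.circle [] (j, true)) ≠ .yellow := fun h => hij ((hyel [] _).1 h).symm
  have hk : κ (P.circle [] (k, true)) ≠ .yellow := fun h => hik ((hyel [] _).1 h).symm
  have hjk' := hne [] (j, true) (k, true) hjk
  rcases hcj : κ (P.circle [] (j, true)) with _ | _ | _
  · exact absurd hcj hj
  · rcases hck : κ (P.circle [] (k, true)) with _ | _ | _
    · exact absurd hck hk
    · exact absurd (hcj.trans hck.symm) hjk'
    · refine ⟨j, k, hij, hik, hjk, fun l p => ⟨hyel l p, ?_⟩⟩
      rw [hconst]
      rcases axis_cases hij hik hjk p.1 with h | h | h <;> rw [h]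
      · simp [hi, hij, hik]
      · simp [hcj, hjk]
      · simp [hck, hjk.symm]
  · rcases hck : κ (P.circle [] (k, true)) with _ | _ | _
    · exact absurd hck hk
    · refine ⟨k, j, hik, hij, hjk.symm, fun l p => ⟨hyel l p, ?_⟩⟩
      rw [hconst]
      rcases axis_cases hij hik hjk p.1 with h | h | h <;> rw [h]
      · simp [hi, hij, hik]
      · simp [hcj, hjk]
      · simp [hck, hjk.symm]
    · exact absurd (hcj.trans hck.symm) hjk'

end OctahedralConfiguration

open OctahedralConfiguration OctVec CurvData in
theorem mainTheorem10 (P : OctahedralConfiguration) (T : OctType)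
    (hint : P.IsIntegral) (hprim : P.IsPrimitive) (htype : P.HasType T)
    (κ : OrientedCircle → OctColor) (hκ : P.IsColoring κ) :
    (∃ ε : ℤ, (ε = 1 ∨ ε = -1) ∧
      P.ChiTwoConstant T κ .red ε ∧ P.ChiTwoConstant T κ .blue (-ε)) ∧
    (P.ChiTwoConstant T κ .red 1 → P.ChiTwoConstant T κ .blue (-1) →
      (∀ C ∈ P.packing, κ C = .blue → ∀ n : ℤ, C.curv ≠ (n : ℝ) ^ 2) ∧
      (∀ C ∈ P.packing, κ C = .red → ∀ n : ℤ, C.curv ≠ 2 * (n : ℝ) ^ 2)) := by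
  obtain ⟨i, Q, hQ, hs, hx⟩ := exists_admissible hint hprim htype
  obtain ⟨j, k, hij, hik, hjk, hcol⟩ := hκ.exists_axis_color hQ hs hx
  have hcurv := curv_circle hs hx
  -- Pairs of circles in the statement correspond to coprime pairs of lattice vectors.
  have hconst : ∀ (c : OctColor) (x : Fin 3) (ε : ℤ),
      (∀ l p, κ (P.circle l p) = c → p.1 = x) →
      (∀ C D, CoprimePair i Q C D → Odd (D.m x) → chiTwo T (eval Q C) (eval Q D) = ε) →
      P.ChiTwoConstant T κ c ε := by
    intro c x ε hc hε C hC D hD ht hCy hDc a b ha hb hab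
    obtain ⟨l, p, rfl⟩ := P.exists_eq_circle hC
    obtain ⟨l', q, rfl⟩ := P.exists_eq_circle hD
    have hp := (hcol l p).1.1 hCy
    have hq := hc l' q hDc
    have ea : eval Q (word l (vertex p)) = a := by rw [hcurv] at ha; exact_mod_cast ha
    have eb : eval Q (word l' (vertex q)) = b := by rw [hcurv] at hb; exact_mod_cast hb
    have pair : CoprimePair i Q (word l (vertex p)) (word l' (vertex q)) :=
      ⟨reached_word_vertex l p, reached_word_vertex l' q, P.tangent_circle_iff.1 ht,
        by rw [odd_word_m, odd_vertex_m, hp], by rw [ea, eb]; exact hab⟩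
    have h1 := hε _ _ pair (by rw [odd_word_m, odd_vertex_m, hq])
    have h2 := hQ.chiTwo_comm pair
    rw [ea, eb] at h1 h2
    exact ⟨h1, h2 ▸ h1⟩
  -- A circle of even curvature has a coprime odd neighbour, which computes its symbol.
  have hsq : ∀ (c : OctColor) (x : Fin 3) (ε : ℤ), x ≠ i →
      (∀ l p, κ (P.circle l p) = c → p.1 = x) → P.ChiTwoConstant T κ c ε →
      ∀ D ∈ P.packing, κ D = c → ∃ b : ℤ, D.curv = b ∧ (∀ n, b = n ^ 2 → ε = 1) ∧
        ∀ n, b = 2 * n ^ 2 → ε = -1 := by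
    intro c x ε hxi hc hε D hD hDc
    obtain ⟨l', q, rfl⟩ := P.exists_eq_circle hD
    have hq := hc l' q hDc
    obtain ⟨C, pair, h1, h2⟩ := hQ.exists_chiTwo_of_sq (reached_word_vertex l' q) hxi
      (by rw [odd_word_m, odd_vertex_m, hq])
    obtain ⟨l, p, rfl⟩ := pair.left.exists_word
    have hp := pair.odd
    rw [odd_word_m, odd_vertex_m] at hp
    have e := (hε _ (P.circle_mem_packing l p) _ (P.circle_mem_packing l' q)
      (P.tangent_circle_iff.2 pair.tangent) ((hcol l p).1.2 hp.symm) hDc _ _ (hcurv l p)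
      (hcurv l' q) pair.coprime).1
    exact ⟨_, hcurv l' q, fun n hn => e.symm.trans (h1 n hn), fun n hn => e.symm.trans (h2 n hn)⟩
  refine ⟨?_, fun hred hblue => ⟨fun C hC hCb n hn => ?_, fun C hC hCr n hn => ?_⟩⟩
  · obtain ⟨ε, hε, h⟩ := hQ.exists_sign hij.symm hjk
    exact ⟨ε, hε, hconst .red j ε (fun l p => (hcol l p).2.1.1) fun C D hCD => (h C D hCD).1,
      hconst .blue k (-ε) (fun l p => (hcol l p).2.2.1) fun C D hCD => (h C D hCD).2⟩
  · obtain ⟨b, hb, h1, -⟩ := hsq .blue k (-1) hik.symm (fun l p => (hcol l p).2.2.1) hblue C hC hCb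
    rw [hb] at hn
    exact absurd (h1 n (by exact_mod_cast hn)) (by decide)
  · obtain ⟨b, hb, -, h2⟩ := hsq .red j 1 hij.symm (fun l p => (hcol l p).2.1.1) hred C hC hCr
    rw [hb] at hn
    exact absurd (h2 n (by exact_mod_cast hn)) (by decide)
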